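/- For $N\ge 1$ let $X=X_N$ be a square matrix of the quaternion Ginibre ensemble (GinSE): an $N\times N$ array of independent random quaternions $a+bi+cj+dk$ whose components $a,b,c,d$ are independent centred real Gaussians of variance $1/4$ (so the joint element density is proportional to $\prod_{j,k} e^{-2|q_{jk}|^2}$), each quaternion being represented by the block $\begin{bmatrix} z & w\\ -\bar w & \bar z\end{bmatrix}$, $z=a+ib$, $w=c+id$, so that $X$ is a $2N\times 2N$ complex matrix. For $s\ge 0$ let $E_N(0;(0,s))$ be the probability that the quaternion Wishart matrix $X^\dagger X$ has no eigenvalue in $(0,s)$, and let $\kappa_N$ be the condition number of $X$, i.e. the ratio of its largest to its smallest singular value. Let ${}_0F_1(b;x)=\sum_{k\ge0}\frac{x^k}{(b)_k\,k!}$ with $(b)_k=b(b+1)\cdots(b+k-1)$. (i) For every $x\ge 0$, $$\lim_{N\to\infty}E_N\bigl(0;(0,x/N)\bigr)=e^{-2x}\,{}_0F_1(1/2;x)=e^{-2x}\cosh(2\sqrt{x}).$$ (ii) As $N\to\infty$, $\kappa_N/(2N)$ converges in distribution to the probability law on $(0,\infty)$ with (non-negative) density $$f(y)=-\frac{2}{y^3}\,\frac{d}{dx}\Bigl(e^{-2x}\cosh(2\sqrt{x})\Bigr)\Big|_{x=1/y^2},\qquad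 y>0.$$ -/

import Mathlib

open MeasureTheory ProbabilityTheory Filter Topology
open scoped Matrix Nat NNReal ENNReal

namespace GinSE

/-- An `N × N` array of real quaternions `a + b i + c j + d k`; entry `(j, k)` has the four real
components `q j k 0, q j k 1, q j k 2, q j k 3`. -/
abbrev QuaternionArray (N : ℕ) : Type := Fin N → Fin N → Fin 4 → ℝ

/-- The joint element distribution of the quaternion Ginibre ensemble: the `4 N ^ 2` real components
are independent centred Gaussians of variance `1 / 4`. The joint density is thus proportional to
`∏ exp (-2 * |q j k| ^ 2)`, and every quaternion entry has mean zero and mean square modulus one. -/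
noncomputable def law (N : ℕ) : Measure (QuaternionArray N) :=
  Measure.pi fun _ : Fin N => Measure.pi fun _ : Fin N => Measure.pi fun _ : Fin 4 =>
    gaussianReal 0 (1 / 4 : ℝ≥0)

instance instIsProbabilityMeasureLaw (N : ℕ) : IsProbabilityMeasure (law N) := by
  unfold law
  infer_instance

/-- The `2 × 2` complex matrix `[[z, w], [-conj w, conj z]]` of a quaternion with components `a`,
where `z = a 0 + i a 1` and `w = a 2 + i a 3`. -/
def quaternionBlock (a : Fin 4 → ℝ) : Matrix (Fin 2) (Fin 2) ℂ :=
  !![⟨a 0, a 1⟩, ⟨a 2, a 3⟩;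
     -(starRingEnd ℂ) ⟨a 2, a 3⟩, (starRingEnd ℂ) ⟨a 0, a 1⟩]

/-- The `2N × 2N` complex matrix (as an `N × N` array of `2 × 2` blocks) of a quaternion array. -/
def toMatrix {N : ℕ} (q : QuaternionArray N) : Matrix (Fin N × Fin 2) (Fin N × Fin 2) ℂ :=
  Matrix.of fun i j => quaternionBlock (q i.1 j.1) i.2 j.2

/-- The eigenvalues of the quaternion Wishart matrix `X† X`, with the (double) multiplicities they
have as a `2N × 2N` complex Hermitian matrix. -/
noncomputable def wishartEigenvalues {N : ℕ} (q : QuaternionArray N) : Fin N × Fin 2 → ℝ :=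
  (Matrix.isHermitian_conjTranspose_mul_self (toMatrix q)).eigenvalues

/-- The gap probability `E_N(0; (0, s))`: the probability that the quaternion Wishart matrix `X† X`
has no eigenvalue in the interval `(0, s)`. -/
noncomputable def gapProb (N : ℕ) (s : ℝ) : ℝ :=
  (law N).real {q | ∀ i, wishartEigenvalues q i ∉ Set.Ioo 0 s}

/-- The condition number: the largest over the smallest of the `2N` singular values of `X`
(Mathlib lists singular values in decreasing order, from index `0`). The value is `0` by convention
if `X` is singular. -/
noncomputable def conditionNumber {N : ℕ} (q : QuaternionArray N) : ℝ :=
  (Matrix.toEuclideanLin (toMatrix q)).singularValues 0 /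
    (Matrix.toEuclideanLin (toMatrix q)).singularValues (2 * N - 1)

/-- The confluent hypergeometric limit function `₀F₁(b; x) = ∑ x ^ k / ((b)_k k!)`. -/
noncomputable def hypergeometric0F1 (b x : ℝ) : ℝ :=
  ∑' k : ℕ, x ^ k / ((ascPochhammer ℝ k).eval b * (k ! : ℝ))

/-- The function `- (2 / y ^ 3) * d/dx (exp (-2 x) cosh (2 √x))` at `x = 1 / y ^ 2` for `y > 0`,
extended by zero to `y ≤ 0`. -/
noncomputable def limitPDF (y : ℝ) : ℝ :=
  if 0 < y then
    -(2 / y ^ 3) * deriv (fun x : ℝ => Real.exp (-2 * x) * Real.cosh (2 * √x)) (1 / y ^ 2)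
  else 0

/-- The measure on the real line with density `limitPDF`. -/
noncomputable def limitLaw : Measure ℝ :=
  volume.withDensity fun y => ENNReal.ofReal (limitPDF y)

end GinSE

/-!
Everything rests on the probability `formProb σ n u t` that the quaternion Ginibre matrix `X` of
size `n + 1` satisfies `X† X ≥ diag (u, t, …, t)` (for `σ = 1`) or `X† X ≤ diag (u, t, …, t)`
(for `σ = -1`). With `u = t` these are the events `σ_min² ≥ t` and `σ_max² ≤ t`.

**The recursion** (`formProb_succ`). The law of `X` is invariant under the quaternionic unitary
group acting from either side (`measurePreserving_of_nsq_eq`). Given the first column of `X`, a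
Householder reflection of the rows (`exists_unitary_mulVec_eq_single`) turns it into a nonnegative
multiple of the first basis vector; then a reflection of the remaining columns does the same with
the rest of the first row. The squared lengths `Q` and `E` of these two vectors are independent and
gamma distributed (`map_nsq_gaussianArray`), and the remaining block is a Ginibre matrix of size
`n`, independent of both. Only the top left `2 × 2` corner of the form involves `Q` and `E`, and
completing the square in the first variable gives a condition of the same kind for the smaller
block, with `t` unchanged and `u` replaced by `t + u E / (Q - u)`, provided that `σ (Q - u) > 0`;
otherwise the event fails.

**The smallest singular value.** For `σ = 1` the recursion preserves the functions of `u` of the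
form `exp (-2 u) (a + b u)`, hence is solved exactly (`formProb_one_eq`). At `u = t = s` the
solution is `P(σ_min² ≥ s) = exp (-2 N s) ∑ k, C(N, k) s ^ k / (1/2)_k`. For `s = x / N` dominated
convergence of the sum gives `exp (-2 x) ₀F₁(1/2; x)` (`tendsto_formProb_one`). The same formula
shows that `X` is almost surely invertible, so that the absence of eigenvalues in `(0, s)` is,
up to a null event, the event `σ_min² ≥ s`.

**The largest singular value.** For `σ = -1` no exact solution is needed: as long as all `Q` and `E`
are below `K`, the recursion with `t = 4 K` keeps `u ≥ 2 K`, because `4 K - 2 K · K / (2 K - K)` is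
again `2 K`; and if they are all above `K`, the recursion with `t < 4 K` lowers `u` by a fixed
fraction of `K` per step, until `u < K` makes the event fail. Chernoff bounds for the gamma law,
with `K` close to `N`, then show that `σ_max² / N → 4` in probability
(`tendsto_formProb_neg_one_one`, `tendsto_formProb_neg_one_zero`).

**The condition number.** Therefore `κ_N / (2 N) ≤ y` is asymptotically the event
`N σ_min² ≥ 1 / y²`, whose probability tends to `exp (-2 x) cosh (2 √x)` at `x = 1 / y²`
(`tendsto_real_conditionNumber_le_of_pos`). This is the distribution function of the limit law
(`limitLaw_Iic`), and convergence of distribution functions implies convergence in distribution.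
-/

/-! ### Gaussian quaternions and their rotation invariance -/

namespace GinSE

open Quaternion

/-- The Borel σ-algebra on the quaternions. -/
noncomputable instance instMeasurableSpaceQuaternion : MeasurableSpace ℍ[ℝ] := borel _

instance instBorelSpaceQuaternion : BorelSpace ℍ[ℝ] := ⟨rfl⟩

instance instSecondCountableTopologyQuaternion : SecondCountableTopology ℍ[ℝ] :=
  haveI := FiniteDimensional.proper_real ℍ[ℝ]
  inferInstance

/-- The quaternion with components `a`. -/
noncomputable def quat (a : Fin 4 → ℝ) : ℍ[ℝ] := ⟨a 0, a 1, a 2, a 3⟩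

lemma quat_eq (a : Fin 4 → ℝ) :
    quat a = linearIsometryEquivTuple.symm (WithLp.toLp 2 a) := rfl

lemma measurable_quat : Measurable quat := by
  have : Continuous quat := by
    have : quat = fun a => linearIsometryEquivTuple.symm (WithLp.toLp 2 a) := funext quat_eq
    rw [this]
    fun_prop
  exact this.measurable

/-- A random quaternion whose four components are independent centred Gaussians of variance
`1 / 4`. -/
noncomputable def quatGaussian : Measure ℍ[ℝ] :=
  (Measure.pi fun _ : Fin 4 => gaussianReal 0 (1 / 4 : ℝ≥0)).map quat

instance instIsProbabilityMeasureQuatGaussian : IsProbabilityMeasure quatGaussian :=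
  Measure.isProbabilityMeasure_map measurable_quat.aemeasurable

lemma measurePreserving_quat :
    MeasurePreserving quat (Measure.pi fun _ : Fin 4 => gaussianReal 0 (1 / 4 : ℝ≥0))
      quatGaussian := ⟨measurable_quat, rfl⟩

/-- Families of independent Gaussian quaternions, indexed by `ι`. -/
noncomputable def gaussianArray (ι : Type*) [Fintype ι] : Measure (ι → ℍ[ℝ]) :=
  Measure.pi fun _ => quatGaussian

instance (ι : Type*) [Fintype ι] : IsProbabilityMeasure (gaussianArray ι) := by
  unfold gaussianArray; infer_instance

lemma charFun_quatGaussian (t : ℍ[ℝ]) :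
    charFun quatGaussian t = Complex.exp (-(‖t‖ ^ 2 / 8 : ℝ)) := by
  have h : quatGaussian = ((Measure.pi fun _ : Fin 4 => gaussianReal 0 (1 / 4 : ℝ≥0)).map
      (WithLp.toLp 2)).map linearIsometryEquivTuple.symm := by
    rw [Measure.map_map (by fun_prop) (by fun_prop)]; rfl
  have h2 : charFun quatGaussian t = charFun ((Measure.pi fun _ : Fin 4 =>
      gaussianReal 0 (1 / 4 : ℝ≥0)).map (WithLp.toLp 2)) (linearIsometryEquivTuple t) := by
    rw [h, charFun_apply, charFun_apply, integral_map (by fun_prop) (by fun_prop)]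
    congr 1; ext x
    rw [← linearIsometryEquivTuple.inner_map_map, LinearIsometryEquiv.apply_symm_apply]
  rw [h2, charFun_pi]
  simp_rw [charFun_gaussianReal, ← Complex.exp_sum]
  congr 1
  rw [← linearIsometryEquivTuple.norm_map t, EuclideanSpace.real_norm_sq_eq]
  push_cast
  simp [Finset.sum_div, ← Finset.sum_neg_distrib]
  exact Finset.sum_congr rfl fun i _ => by ring

/-- The real Euclidean space underlying `ι → ℍ`. -/
abbrev QVec (ι : Type*) : Type _ := PiLp 2 fun _ : ι => ℍ[ℝ]

lemma charFun_gaussianArray {ι : Type*} [Fintype ι] (t : QVec ι) :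
    charFun ((gaussianArray ι).map (WithLp.toLp 2)) t = Complex.exp (-(‖t‖ ^ 2 / 8 : ℝ)) := by
  rw [gaussianArray, charFun_pi]
  simp_rw [charFun_quatGaussian, ← Complex.exp_sum]
  rw [PiLp.norm_sq_eq_of_L2]
  push_cast
  simp [Finset.sum_div]

/-- The squared Euclidean length of a quaternionic vector. -/
noncomputable def nsq {ι : Type*} [Fintype ι] (v : ι → ℍ[ℝ]) : ℝ := ∑ i, ‖v i‖ ^ 2

/-- Rotation invariance: a Gaussian vector of quaternions is preserved by the real linear
isometries of the real Euclidean space underlying `ι → ℍ`. -/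
lemma measurePreserving_of_nsq_eq {ι : Type*} [Fintype ι]
    (f : (ι → ℍ[ℝ]) →ₗ[ℝ] (ι → ℍ[ℝ])) (hf : ∀ v, nsq (f v) = nsq v) :
    MeasurePreserving f (gaussianArray ι) (gaussianArray ι) := by
  have hfc : Continuous f := f.continuous_of_finiteDimensional
  refine ⟨hfc.measurable, ?_⟩
  let g₀ : QVec ι →ₗᵢ[ℝ] QVec ι :=
    { toLinearMap := (WithLp.linearEquiv 2 ℝ (ι → ℍ[ℝ])).symm.toLinearMap ∘ₗ f ∘ₗ
        (WithLp.linearEquiv 2 ℝ (ι → ℍ[ℝ])).toLinearMap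
      norm_map' := fun x => by
        rw [← sq_eq_sq₀ (norm_nonneg _) (norm_nonneg _), PiLp.norm_sq_eq_of_L2,
          PiLp.norm_sq_eq_of_L2]
        exact hf _ }
  let g : QVec ι ≃ₗᵢ[ℝ] QVec ι := g₀.toLinearIsometryEquiv rfl
  have hg : ∀ x : ι → ℍ[ℝ], g (WithLp.toLp 2 x) = WithLp.toLp 2 (f x) := fun x => rfl
  have key : ((gaussianArray ι).map (WithLp.toLp 2)).map g =
      (gaussianArray ι).map (WithLp.toLp 2) := by
    have : IsProbabilityMeasure ((gaussianArray ι).map (WithLp.toLp 2)) :=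
      Measure.isProbabilityMeasure_map (by fun_prop)
    have : IsProbabilityMeasure (((gaussianArray ι).map (WithLp.toLp 2)).map g) :=
      Measure.isProbabilityMeasure_map (by fun_prop)
    refine Measure.ext_of_charFun (E := QVec ι) ?_
    ext t
    have : charFun (((gaussianArray ι).map (WithLp.toLp 2)).map g) t =
        charFun ((gaussianArray ι).map (WithLp.toLp 2)) (g.symm t) := by
      rw [charFun_apply, charFun_apply, integral_map (by fun_prop) (by fun_prop)]
      congr 1; ext x
      rw [← g.symm.inner_map_map, g.symm_apply_apply]
    rw [this, charFun_gaussianArray, charFun_gaussianArray, g.symm.norm_map]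
  have h2 := congrArg (Measure.map (WithLp.ofLp : QVec ι → _)) key
  rw [Measure.map_map (by fun_prop) (by fun_prop), Measure.map_map (by fun_prop) (by fun_prop),
    Measure.map_map (by fun_prop) (by fun_prop)] at h2
  have e1 : ((WithLp.ofLp ∘ (g : QVec ι → QVec ι)) ∘ (WithLp.toLp 2) : (ι → ℍ[ℝ]) → _) = f := by
    ext x : 1; exact congrArg (WithLp.ofLp : QVec ι → _) (hg x)
  have e2 : (WithLp.ofLp ∘ (WithLp.toLp 2) : (ι → ℍ[ℝ]) → _) = id := rfl
  rw [e1, e2, Measure.map_id] at h2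
  exact h2

/-- The quaternion array of the Ginibre ensemble as a family of quaternions. -/
noncomputable def toQuat {N : ℕ} (q : QuaternionArray N) : Fin N × Fin N → ℍ[ℝ] :=
  fun p => quat (q p.1 p.2)

lemma measurePreserving_uncurry {ι κ : Type*} [Fintype ι] [Fintype κ] :
    MeasurePreserving (fun (q : ι → κ → ℍ[ℝ]) (p : ι × κ) => q p.1 p.2)
      (Measure.pi fun _ => Measure.pi fun _ => quatGaussian) (gaussianArray (ι × κ)) := by
  have hm : Measurable (fun (q : ι → κ → ℍ[ℝ]) (p : ι × κ) => q p.1 p.2) := by fun_prop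
  refine ⟨hm, (Measure.pi_eq fun s hs => ?_).symm⟩
  rw [Measure.map_apply hm (.univ_pi hs)]
  have : (fun (q : ι → κ → ℍ[ℝ]) (p : ι × κ) => q p.1 p.2) ⁻¹' Set.univ.pi s =
      Set.univ.pi fun i => Set.univ.pi fun j => s (i, j) := by
    ext q; simp [Set.mem_pi]
  rw [this, Measure.pi_pi]
  simp_rw [Measure.pi_pi]
  rw [Fintype.prod_prod_type]

lemma measurePreserving_toQuat (N : ℕ) :
    MeasurePreserving (toQuat (N := N)) (law N) (gaussianArray (Fin N × Fin N)) := by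
  have h1 : MeasurePreserving (fun (q : QuaternionArray N) i j => quat (q i j)) (law N)
      (Measure.pi fun _ => Measure.pi fun _ => quatGaussian) :=
    measurePreserving_pi _ _ fun _ => measurePreserving_pi _ _ fun _ => measurePreserving_quat
  exact measurePreserving_uncurry.comp h1

/-- Independent blocks of a Gaussian array, put together along a partition of the index set. -/
lemma measurePreserving_sumElim {ι κ τ : Type*} [Fintype ι] [Fintype κ] [Fintype τ]
    (e : τ ≃ ι ⊕ κ) :
    MeasurePreserving (fun (z : (ι → ℍ[ℝ]) × (κ → ℍ[ℝ])) (i : τ) => Sum.elim z.1 z.2 (e i))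
      ((gaussianArray ι).prod (gaussianArray κ)) (gaussianArray τ) := by
  have hm : Measurable
      (fun (z : (ι → ℍ[ℝ]) × (κ → ℍ[ℝ])) (i : τ) => Sum.elim z.1 z.2 (e i)) := by
    refine measurable_pi_lambda _ fun i => ?_
    rcases e i with j | j
    · exact (measurable_pi_apply j).comp measurable_fst
    · exact (measurable_pi_apply j).comp measurable_snd
  refine ⟨hm, (Measure.pi_eq fun s hs => ?_).symm⟩
  rw [Measure.map_apply hm (.univ_pi hs)]
  have : (fun (z : (ι → ℍ[ℝ]) × (κ → ℍ[ℝ])) (i : τ) => Sum.elim z.1 z.2 (e i)) ⁻¹' Set.univ.pi s =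
      (Set.univ.pi fun i => s (e.symm (.inl i))) ×ˢ (Set.univ.pi fun i => s (e.symm (.inr i))) := by
    ext z
    simp only [Set.mem_preimage, Set.mem_pi, Set.mem_univ, true_imp_iff, Set.mem_prod]
    rw [← e.symm.forall_congr_right]
    simp
  rw [this, Measure.prod_prod, gaussianArray, gaussianArray, Measure.pi_pi, Measure.pi_pi,
    ← e.symm.prod_comp, Fintype.prod_sum_type]

end GinSE

/-! ### The gamma law of the squared length -/

namespace GinSE

open Quaternion Set

lemma integrableOn_pow_mul_cexp (k : ℕ) {b : ℂ} (hb : 0 < b.re) :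
    IntegrableOn (fun x : ℝ => (x : ℂ) ^ k * Complex.exp (-b * x)) (Ioi 0) := by
  have h := integrableOn_rpow_mul_exp_neg_mul_rpow (p := 1) (s := k) (b := b.re)
    (by have : (0 : ℝ) ≤ k := k.cast_nonneg
        linarith) one_pos hb
  refine h.mono' (by fun_prop) ?_
  filter_upwards [ae_restrict_mem measurableSet_Ioi] with x hx
  have hx : (0 : ℝ) < x := hx
  simp [Complex.norm_exp, abs_of_pos hx]

lemma integral_pow_mul_cexp (k : ℕ) {b : ℂ} (hb : 0 < b.re) :
    ∫ x in Ioi (0 : ℝ), (x : ℂ) ^ k * Complex.exp (-b * x) = k ! / b ^ (k + 1) := by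
  have hb0 : b ≠ 0 := by rintro rfl; simp at hb
  have htend : ∀ k : ℕ, Tendsto (fun x : ℝ => (x : ℂ) ^ k * Complex.exp (-b * x)) atTop (𝓝 0) := by
    intro k
    rw [tendsto_zero_iff_norm_tendsto_zero]
    refine (tendsto_rpow_mul_exp_neg_mul_atTop_nhds_zero k b.re hb).congr' ?_
    filter_upwards [eventually_gt_atTop 0] with x hx
    simp [Complex.norm_exp, abs_of_pos hx]
  induction k with
  | zero =>
    have hd : ∀ x ∈ Ici (0 : ℝ), HasDerivAt (fun x : ℝ => -b⁻¹ * Complex.exp (-b * x))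
        ((x : ℂ) ^ 0 * Complex.exp (-b * x)) x := by
      intro x _
      have h1 : HasDerivAt (fun x : ℝ => -b * (x : ℂ)) (-b) x := by
        simpa using (Complex.ofRealCLM.hasDerivAt (x := x)).const_mul (-b)
      convert! (h1.cexp.const_mul (-b⁻¹)) using 1
      field_simp
    have := integral_Ioi_of_hasDerivAt_of_tendsto' hd (integrableOn_pow_mul_cexp 0 hb)
      (by simpa using (htend 0).const_mul (-b⁻¹))
    rw [this]; simp
  | succ k ih =>
    have hd : ∀ x ∈ Ici (0 : ℝ), HasDerivAt (fun x : ℝ => (x : ℂ) ^ (k + 1) * Complex.exp (-b * x))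
        ((k + 1) * ((x : ℂ) ^ k * Complex.exp (-b * x)) -
          b * ((x : ℂ) ^ (k + 1) * Complex.exp (-b * x))) x := by
      intro x _
      have h0 : HasDerivAt (fun x : ℝ => (x : ℂ)) 1 x := Complex.ofRealCLM.hasDerivAt (x := x)
      have h1 : HasDerivAt (fun x : ℝ => -b * (x : ℂ)) (-b) x := by
        simpa using h0.const_mul (-b)
      convert! (h0.pow (k + 1)).mul h1.cexp using 1
      simp; ring
    have i1 := (integrableOn_pow_mul_cexp k hb).const_mul ((k : ℂ) + 1)
    have i2 := (integrableOn_pow_mul_cexp (k + 1) hb).const_mul b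
    have := integral_Ioi_of_hasDerivAt_of_tendsto' hd (i1.sub i2) (htend (k + 1))
    rw [integral_sub i1 i2, integral_const_mul, integral_const_mul, ih] at this
    simp at this
    have h3 : b * ∫ x in Ioi (0 : ℝ), (x : ℂ) ^ (k + 1) * Complex.exp (-(b * x)) =
        (k + 1) * (k ! / b ^ (k + 1)) := by linear_combination -this
    simp only [neg_mul]
    rw [← mul_right_inj' hb0, h3, Nat.factorial_succ]
    push_cast
    field_simp
    ring

lemma integrableOn_pow_mul_exp (k : ℕ) {b : ℝ} (hb : 0 < b) :
    IntegrableOn (fun x : ℝ => x ^ k * Real.exp (-b * x)) (Ioi 0) := by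
  have := (integrableOn_pow_mul_cexp k (b := b) (by simpa)).re
  refine this.congr (ae_of_all _ fun x => ?_)
  have : (x : ℂ) ^ k * Complex.exp (-b * x) = ((x ^ k * Real.exp (-b * x) : ℝ) : ℂ) := by
    push_cast; rfl
  simp only [this, RCLike.re_eq_complex_re, Complex.ofReal_re]

lemma integral_pow_mul_exp (k : ℕ) {b : ℝ} (hb : 0 < b) :
    ∫ x in Ioi (0 : ℝ), x ^ k * Real.exp (-b * x) = k ! / b ^ (k + 1) := by
  have := integral_pow_mul_cexp k (b := b) (by simpa)
  have h2 : ∀ x : ℝ, (x : ℂ) ^ k * Complex.exp (-b * x) =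
      ((x ^ k * Real.exp (-b * x) : ℝ) : ℂ) := by
    intro x; push_cast; rfl
  simp_rw [h2] at this
  rw [integral_complex_ofReal] at this
  exact_mod_cast this

/-- The gamma distribution of shape `2 (k + 1)` and rate `2`: the law of the squared length of a
vector of `k + 1` independent Gaussian quaternions. -/
noncomputable def radial (k : ℕ) : Measure ℝ := gammaMeasure (2 * k + 2) 2

instance (k : ℕ) : IsProbabilityMeasure (radial k) :=
  isProbabilityMeasure_gammaMeasure (by positivity) two_pos

lemma integral_radial {E : Type*} [NormedAddCommGroup E] [NormedSpace ℝ E] (k : ℕ) (f : ℝ → E) :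
    ∫ x, f x ∂(radial k) = ∫ x in Ioi 0,
      ((2 : ℝ) ^ (2 * k + 2) / (2 * k + 1)! * (x ^ (2 * k + 1) * Real.exp (-2 * x))) • f x := by
  have hm : Measurable (gammaPDFReal (2 * k + 2) 2) := measurable_gammaPDFReal _ _
  rw [radial, gammaMeasure, integral_withDensity_eq_integral_toReal_smul
    (by unfold gammaPDF; fun_prop) (by simp [gammaPDF]),
    ← integral_indicator measurableSet_Ioi]
  refine integral_congr_ae ?_
  filter_upwards [compl_mem_ae_iff.2 (measure_singleton (0 : ℝ))] with x hx
  have hx : x ≠ 0 := hx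
  rw [gammaPDF, ENNReal.toReal_ofReal (gammaPDFReal_nonneg (by positivity) two_pos x),
    gammaPDFReal]
  rcases lt_or_gt_of_ne hx with h | h
  · simp [h.not_ge, h.le]
  · rw [if_pos h.le, indicator_of_mem (by exact h)]
    congr 1
    have e1 : (2 * k + 2 : ℝ) = ((2 * k + 1 : ℕ) : ℝ) + 1 := by push_cast; ring
    rw [e1, Real.Gamma_nat_eq_factorial, add_sub_cancel_right, Real.rpow_natCast,
      ← Nat.cast_succ, Real.rpow_natCast]
    simp only [Nat.succ_eq_add_one]
    ring_nf

lemma radial_Iio_zero (k : ℕ) : radial k (Iio 0) = 0 := by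
  rw [radial, gammaMeasure, withDensity_apply _ measurableSet_Iio]
  exact lintegral_gammaPDF_of_nonpos le_rfl

instance (k : ℕ) : NullSingletonClass (radial k) :=
  ⟨fun x => withDensity_absolutelyContinuous _ _ (measure_singleton x)⟩

lemma ae_radial_pos (k : ℕ) : ∀ᵐ x ∂(radial k), 0 < x := by
  rw [ae_iff]
  have : {a : ℝ | ¬ 0 < a} = Iio 0 ∪ {0} := by
    ext x; simp [le_iff_lt_or_eq]
  rw [this]
  exact measure_union_null (radial_Iio_zero k) (measure_singleton _)

lemma charFun_radial (k : ℕ) (t : ℝ) :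
    charFun (radial k) t = (2 / (2 - t * Complex.I)) ^ (2 * k + 2) := by
  have hb : 0 < (2 - t * Complex.I).re := by simp
  rw [charFun_apply_real, integral_radial]
  have h1 : ∀ x : ℝ, ((2 : ℝ) ^ (2 * k + 2) / (2 * k + 1)! *
      (x ^ (2 * k + 1) * Real.exp (-2 * x))) • Complex.exp (t * x * Complex.I) =
      (2 : ℂ) ^ (2 * k + 2) / (2 * k + 1)! *
        ((x : ℂ) ^ (2 * k + 1) * Complex.exp (-(2 - t * Complex.I) * x)) := by
    intro x
    rw [Complex.real_smul]
    push_cast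
    rw [show -(2 - t * Complex.I) * x = -2 * x + t * x * Complex.I by ring, Complex.exp_add]
    ring
  simp_rw [h1]
  rw [integral_const_mul, integral_pow_mul_cexp _ hb, div_pow]
  have : ((2 * k + 1)! : ℂ) ≠ 0 := by exact_mod_cast Nat.factorial_ne_zero _
  field_simp

/-- The sum of four independent squared Gaussians of variance `1 / 4` has the gamma law of shape `2`
and rate `2`. -/
lemma charFun_gaussian_sq_pow_four (t : ℝ) :
    charFun ((gaussianReal 0 (1 / 4 : ℝ≥0)).map fun x => x ^ 2) t ^ 4 =
      (2 / (2 - t * Complex.I)) ^ 2 := by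
  have hb : 0 < (2 - t * Complex.I).re := by simp
  have hb0 : (2 - t * Complex.I) ≠ 0 := by intro h; rw [h] at hb; simp at hb
  rw [charFun_apply_real, integral_map (by fun_prop) (by fun_prop),
    integral_gaussianReal_eq_integral_smul (by norm_num)]
  have h1 : ∀ x : ℝ, gaussianPDFReal 0 (1 / 4 : ℝ≥0) x • Complex.exp (t * (x ^ 2 : ℝ) * Complex.I) =
      ((√(Real.pi / 2))⁻¹ : ℝ) * Complex.exp (-(2 - t * Complex.I) * (x : ℂ) ^ 2) := by
    intro x
    rw [gaussianPDFReal, Complex.real_smul, Complex.ofReal_mul, mul_assoc]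
    congr 2
    · congr 2
      push_cast; ring
    · rw [Complex.ofReal_exp, ← Complex.exp_add]
      congr 1
      push_cast; ring
  simp_rw [h1]
  rw [integral_const_mul, integral_gaussian_complex hb, mul_pow, ← Complex.cpow_nat_mul]
  norm_num
  rw [show (4 : ℕ) = 2 * 2 from rfl, pow_mul, div_pow, ← Complex.ofReal_pow, ← Complex.ofReal_pow,
    Real.sq_sqrt two_pos.le, Real.sq_sqrt Real.pi_pos.le]
  have : (Real.pi : ℂ) ≠ 0 := by exact_mod_cast Real.pi_ne_zero
  push_cast
  field_simp

lemma charFun_quatGaussian_norm_sq (t : ℝ) :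
    charFun (quatGaussian.map fun x => ‖x‖ ^ 2) t = (2 / (2 - t * Complex.I)) ^ 2 := by
  have h : quatGaussian.map (fun x => ‖x‖ ^ 2) =
      (Measure.pi fun _ : Fin 4 => (gaussianReal 0 (1 / 4 : ℝ≥0)).map fun x => x ^ 2).map
        fun p => ∑ i, p i := by
    rw [← Measure.pi_map_pi (by fun_prop), quatGaussian, Measure.map_map (by fun_prop)
      measurable_quat, Measure.map_map (by fun_prop) (by fun_prop)]
    congr 1
    ext a
    simp only [Function.comp_apply, quat_eq, LinearIsometryEquiv.norm_map,
      EuclideanSpace.real_norm_sq_eq]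
  have : IsProbabilityMeasure ((gaussianReal 0 (1 / 4 : ℝ≥0)).map fun x => x ^ 2) :=
    Measure.isProbabilityMeasure_map (by fun_prop)
  rw [h, charFun_map_sum_pi_eq_prod, Finset.prod_apply, Fin.prod_const,
    charFun_gaussian_sq_pow_four]

lemma measurable_nsq {ι : Type*} [Fintype ι] : Measurable (nsq : (ι → ℍ[ℝ]) → ℝ) := by
  unfold nsq; fun_prop

lemma map_nsq_gaussianArray (k : ℕ) :
    (gaussianArray (Fin (k + 1))).map nsq = radial k := by
  have h : (gaussianArray (Fin (k + 1))).map nsq =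
      (Measure.pi fun _ : Fin (k + 1) => quatGaussian.map fun x => ‖x‖ ^ 2).map
        fun p => ∑ i, p i := by
    rw [← Measure.pi_map_pi (by fun_prop), Measure.map_map (by fun_prop) (by fun_prop)]
    rfl
  have : IsProbabilityMeasure (quatGaussian.map fun x => ‖x‖ ^ 2) :=
    Measure.isProbabilityMeasure_map (by fun_prop)
  have : IsProbabilityMeasure ((gaussianArray (Fin (k + 1))).map nsq) :=
    Measure.isProbabilityMeasure_map measurable_nsq.aemeasurable
  refine Measure.ext_of_charFun ?_
  ext t
  rw [charFun_radial, h, charFun_map_sum_pi_eq_prod, Finset.prod_apply, Fin.prod_const,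
    charFun_quatGaussian_norm_sq, ← pow_mul]
  ring_nf

end GinSE

/-! ### Quaternionic Householder reflections -/

namespace GinSE

open Quaternion Set

variable {ι κ : Type*} [Fintype ι] [Fintype κ]

lemma coe_nsq (v : ι → ℍ[ℝ]) : ((nsq v : ℝ) : ℍ[ℝ]) = star v ⬝ᵥ v := by
  simp only [nsq, dotProduct, Pi.star_apply, Quaternion.star_mul_self, normSq_eq_norm_mul_self]
  simp_rw [sq]
  exact map_sum (algebraMap ℝ ℍ[ℝ]) _ _

lemma nsq_nonneg (v : ι → ℍ[ℝ]) : 0 ≤ nsq v := Finset.sum_nonneg fun _ _ => by positivity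

lemma nsq_eq_zero {v : ι → ℍ[ℝ]} : nsq v = 0 ↔ v = 0 := by
  rw [nsq, Finset.sum_eq_zero_iff_of_nonneg (fun _ _ => by positivity)]
  simp [funext_iff]

lemma nsq_star (v : ι → ℍ[ℝ]) : nsq (star v) = nsq v := by
  simp [nsq]

lemma nsq_mulVec [DecidableEq κ] {U : Matrix ι κ ℍ[ℝ]} (hU : Uᴴ * U = 1) (v : κ → ℍ[ℝ]) :
    nsq (U *ᵥ v) = nsq v := by
  apply Quaternion.coe_injective
  rw [coe_nsq, coe_nsq, Matrix.star_mulVec, Matrix.dotProduct_mulVec, Matrix.vecMul_vecMul, hU,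
    Matrix.vecMul_one]

/-- Quaternionic unitary groups act transitively on spheres: a vector can be rotated to a
nonnegative real multiple of the first basis vector. The rotation is a Householder reflection,
preceded by the multiplication with a unit quaternion that makes the first entry real. -/
lemma exists_unitary_mulVec_eq_single {m : ℕ} (x : Fin (m + 1) → ℍ[ℝ]) :
    ∃ U : Matrix (Fin (m + 1)) (Fin (m + 1)) ℍ[ℝ], Uᴴ * U = 1 ∧ U * Uᴴ = 1 ∧
      U *ᵥ x = Pi.single 0 ((√(nsq x) : ℝ) : ℍ[ℝ]) := by
  classical
  obtain ⟨ω, hω1, hω2, hωx⟩ : ∃ ω : ℍ[ℝ], ω * star ω = 1 ∧ star ω * ω = 1 ∧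
      ω * x 0 = ((‖x 0‖ : ℝ) : ℍ[ℝ]) := by
    by_cases h0 : x 0 = 0
    · exact ⟨1, by simp, by simp, by simp [h0]⟩
    · have hn : (‖x 0‖ : ℝ) ≠ 0 := norm_ne_zero_iff.2 h0
      have hs : star (x 0) * x 0 = ((‖x 0‖ * ‖x 0‖ : ℝ) : ℍ[ℝ]) := by
        rw [Quaternion.star_mul_self, normSq_eq_norm_mul_self]
      have hs' : x 0 * star (x 0) = ((‖x 0‖ * ‖x 0‖ : ℝ) : ℍ[ℝ]) := by
        rw [Quaternion.self_mul_star, normSq_eq_norm_mul_self]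
      have hone : ‖x 0‖⁻¹ * ‖x 0‖⁻¹ * (‖x 0‖ * ‖x 0‖) = 1 := by field_simp
      refine ⟨(‖x 0‖⁻¹ : ℝ) • star (x 0), ?_, ?_, ?_⟩
      · rw [Quaternion.star_smul, star_star, smul_mul_smul_comm, hs, ← Quaternion.coe_smul,
          smul_eq_mul, hone, Quaternion.coe_one]
      · rw [Quaternion.star_smul, star_star, smul_mul_smul_comm, hs', ← Quaternion.coe_smul,
          smul_eq_mul, hone, Quaternion.coe_one]
      · rw [smul_mul_assoc, hs, ← Quaternion.coe_smul]
        simp [hn]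
  set D : Matrix (Fin (m + 1)) (Fin (m + 1)) ℍ[ℝ] := Matrix.diagonal fun _ => ω with hD
  have hDD : Dᴴ * D = 1 := by simp [hD, Matrix.diagonal_conjTranspose, hω2]
  have hDD' : D * Dᴴ = 1 := by simp [hD, Matrix.diagonal_conjTranspose, hω1]
  set y := D *ᵥ x with hy
  have hy0 : y 0 = ((‖x 0‖ : ℝ) : ℍ[ℝ]) := by
    rw [hy, hD, Matrix.mulVec_diagonal, hωx]
  have hny : nsq y = nsq x := nsq_mulVec hDD x
  set ρ := √(nsq x) with hρ
  have hρ2 : ρ ^ 2 = nsq x := Real.sq_sqrt (nsq_nonneg x)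
  set w : Fin (m + 1) → ℍ[ℝ] := y - Pi.single 0 (ρ : ℍ[ℝ]) with hw
  by_cases hw0 : w = 0
  · exact ⟨D, hDD, hDD', sub_eq_zero.1 hw0⟩
  have hwne : nsq w ≠ 0 := fun h => hw0 (nsq_eq_zero.1 h)
  have hwy : star w ⬝ᵥ y = ((nsq x - ρ * ‖x 0‖ : ℝ) : ℍ[ℝ]) := by
    rw [hw, star_sub, sub_dotProduct, ← coe_nsq, hny, ← Pi.single_star, single_dotProduct, hy0]
    simp
  have hww : ((nsq w : ℝ) : ℍ[ℝ]) = ((2 * (nsq x - ρ * ‖x 0‖) : ℝ) : ℍ[ℝ]) := by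
    rw [coe_nsq]
    nth_rewrite 2 [hw]
    rw [dotProduct_sub, hwy, hw, dotProduct_single]
    simp only [Pi.star_apply, Pi.sub_apply, hy0, Pi.single_eq_same, star_sub, Quaternion.star_coe]
    rw [← Quaternion.coe_sub, ← Quaternion.coe_mul, ← Quaternion.coe_sub]
    congr 1
    nlinarith [hρ2]
  have hww' := Quaternion.coe_injective hww
  set c : ℝ := 2 / nsq w with hc
  set H : Matrix (Fin (m + 1)) (Fin (m + 1)) ℍ[ℝ] := 1 - c • Matrix.vecMulVec w (star w) with hH
  have hHs : Hᴴ = H := by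
    rw [hH, Matrix.conjTranspose_sub, Matrix.conjTranspose_one]
    congr 1
    ext1 i j
    simp only [Matrix.conjTranspose_apply, Matrix.smul_apply, Matrix.vecMulVec_apply,
      Quaternion.star_smul, star_mul, Pi.star_apply, star_star]
  have hvv : Matrix.vecMulVec w (star w) * Matrix.vecMulVec w (star w) =
      nsq w • Matrix.vecMulVec w (star w) := by
    rw [Matrix.vecMulVec_mul_vecMulVec, ← coe_nsq]
    ext1 i j
    simp only [Matrix.vecMulVec_apply, Matrix.smul_apply, Pi.smul_apply, smul_eq_mul,
      Quaternion.coe_mul_eq_smul, mul_smul_comm]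
  have hHH : H * H = 1 := by
    rw [hH, sub_mul, mul_sub, mul_sub, one_mul, mul_one, smul_mul_smul_comm, hvv, smul_smul,
      one_mul]
    rw [show c * c * nsq w = 2 * c by rw [hc]; field_simp, two_mul, add_smul]
    abel
  have hHy : H *ᵥ y = Pi.single 0 (ρ : ℍ[ℝ]) := by
    have : Matrix.vecMulVec w (star w) *ᵥ y = (nsq w / 2) • w := by
      rw [Matrix.vecMulVec_mulVec, hwy, hww', mul_div_cancel_left₀ _ two_ne_zero]
      ext1 i
      simp only [Pi.smul_apply, MulOpposite.smul_eq_mul_unop, MulOpposite.unop_op,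
        Quaternion.mul_coe_eq_smul]
    rw [hH, Matrix.sub_mulVec, Matrix.one_mulVec, Matrix.smul_mulVec, this, smul_smul,
      show c * (nsq w / 2) = 1 by rw [hc]; field_simp, one_smul, hw, sub_sub_cancel]
  refine ⟨H * D, ?_, ?_, ?_⟩
  · rw [Matrix.conjTranspose_mul, hHs, mul_assoc, ← mul_assoc H, hHH, one_mul, hDD]
  · rw [Matrix.conjTranspose_mul, hHs, mul_assoc, ← mul_assoc D, hDD', one_mul, hHH]
  · rw [← Matrix.mulVec_mulVec, ← hy, hHy]

end GinSE

/-! ### Rotating the first column and the first row -/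

namespace GinSE

open Quaternion Set

/-- The matrix with entries `X`. -/
def mat {ι κ : Type*} (X : ι × κ → ℍ[ℝ]) : Matrix ι κ ℍ[ℝ] := Matrix.of fun i j => X (i, j)

/-- Left multiplication by a unitary matrix preserves the Gaussian measure. -/
lemma measurePreserving_unitary_mul {ι κ : Type*} [Fintype ι] [Fintype κ] [DecidableEq ι]
    {U : Matrix ι ι ℍ[ℝ]} (hU : Uᴴ * U = 1) :
    MeasurePreserving (fun (Y : ι × κ → ℍ[ℝ]) p => (U * mat Y) p.1 p.2)
      (gaussianArray (ι × κ)) (gaussianArray (ι × κ)) := by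
  let f : (ι × κ → ℍ[ℝ]) →ₗ[ℝ] (ι × κ → ℍ[ℝ]) :=
    { toFun := fun Y p => (U * mat Y) p.1 p.2
      map_add' := fun Y Z => by
        ext1 p
        simp [Matrix.mul_apply, mat, mul_add, Finset.sum_add_distrib]
      map_smul' := fun c Y => by
        ext1 p
        simp only [Matrix.mul_apply, mat, Matrix.of_apply, Pi.smul_apply, mul_smul_comm,
          Finset.smul_sum, RingHom.id_apply] }
  refine measurePreserving_of_nsq_eq f fun Y => ?_
  have h : ∀ Y : ι × κ → ℍ[ℝ], nsq Y = ∑ j, nsq fun i => Y (i, j) := fun Y => by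
    simp_rw [nsq]
    rw [Fintype.sum_prod_type_right]
  rw [h, h]
  refine Finset.sum_congr rfl fun j _ => ?_
  have : (fun i => f Y (i, j)) = U *ᵥ fun i => Y (i, j) := rfl
  rw [this, nsq_mulVec hU]

/-- Right multiplication by a unitary matrix preserves the Gaussian measure. -/
lemma measurePreserving_mul_unitary {ι κ : Type*} [Fintype ι] [Fintype κ] [DecidableEq κ]
    {V : Matrix κ κ ℍ[ℝ]} (hV : V * Vᴴ = 1) :
    MeasurePreserving (fun (Y : ι × κ → ℍ[ℝ]) p => (mat Y * V) p.1 p.2)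
      (gaussianArray (ι × κ)) (gaussianArray (ι × κ)) := by
  let f : (ι × κ → ℍ[ℝ]) →ₗ[ℝ] (ι × κ → ℍ[ℝ]) :=
    { toFun := fun Y p => (mat Y * V) p.1 p.2
      map_add' := fun Y Z => by
        ext1 p
        simp [Matrix.mul_apply, mat, add_mul, Finset.sum_add_distrib]
      map_smul' := fun c Y => by
        ext1 p
        simp only [Matrix.mul_apply, mat, Matrix.of_apply, Pi.smul_apply, smul_mul_assoc,
          Finset.smul_sum, RingHom.id_apply] }
  refine measurePreserving_of_nsq_eq f fun Y => ?_
  have h : ∀ Y : ι × κ → ℍ[ℝ], nsq Y = ∑ i, nsq fun j => Y (i, j) := fun Y => by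
    simp_rw [nsq]
    rw [Fintype.sum_prod_type]
  rw [h, h]
  refine Finset.sum_congr rfl fun i _ => ?_
  have : (fun j => f Y (i, j)) = star (Vᴴ *ᵥ star fun j => Y (i, j)) := by
    rw [Matrix.star_mulVec, star_star, Matrix.conjTranspose_conjTranspose]
    rfl
  rw [this, nsq_star, nsq_mulVec (by rwa [Matrix.conjTranspose_conjTranspose]), nsq_star]

/-- Splitting off the first column of an array. -/
def splitColumn (m n : ℕ) : Fin m × Fin (n + 1) ≃ Fin m ⊕ Fin m × Fin n where
  toFun p := Fin.cases (.inl p.1) (fun j => .inr (p.1, j)) p.2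
  invFun := Sum.elim (fun i => (i, 0)) fun p => (p.1, p.2.succ)
  left_inv := by
    rintro ⟨i, j⟩
    refine Fin.cases ?_ (fun j => ?_) j <;> simp
  right_inv := by rintro (i | p) <;> simp

/-- Splitting off the first row of an array. -/
def splitRow (m n : ℕ) : Fin (m + 1) × Fin n ≃ Fin n ⊕ Fin m × Fin n where
  toFun p := Fin.cases (.inl p.2) (fun i => .inr (i, p.2)) p.1
  invFun := Sum.elim (fun j => (0, j)) fun p => (p.1.succ, p.2)
  left_inv := by
    rintro ⟨i, j⟩
    refine Fin.cases ?_ (fun j => ?_) i <;> simp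
  right_inv := by rintro (i | p) <;> simp

/-- The array with first column `x` and remaining columns `Y`. -/
def consColumn {m n : ℕ} (x : Fin m → ℍ[ℝ]) (Y : Fin m × Fin n → ℍ[ℝ]) :
    Fin m × Fin (n + 1) → ℍ[ℝ] := fun p => Sum.elim x Y (splitColumn m n p)

/-- The array with first row `r` and remaining rows `Z`. -/
def consRow {m n : ℕ} (r : Fin n → ℍ[ℝ]) (Z : Fin m × Fin n → ℍ[ℝ]) :
    Fin (m + 1) × Fin n → ℍ[ℝ] := fun p => Sum.elim r Z (splitRow m n p)

lemma mat_consColumn_mulVec {m n : ℕ} (x : Fin m → ℍ[ℝ]) (Y : Fin m × Fin n → ℍ[ℝ])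
    (v : Fin (n + 1) → ℍ[ℝ]) :
    mat (consColumn x Y) *ᵥ v = fun i => x i * v 0 + (mat Y *ᵥ fun j => v j.succ) i := by
  ext1 i
  simp only [Matrix.mulVec, dotProduct, Fin.sum_univ_succ]
  rfl

lemma mat_consRow_mulVec_zero {m n : ℕ} (r : Fin n → ℍ[ℝ]) (Z : Fin m × Fin n → ℍ[ℝ])
    (v : Fin n → ℍ[ℝ]) : (mat (consRow r Z) *ᵥ v) 0 = r ⬝ᵥ v := rfl

lemma mat_consRow_mulVec_succ {m n : ℕ} (r : Fin n → ℍ[ℝ]) (Z : Fin m × Fin n → ℍ[ℝ])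
    (v : Fin n → ℍ[ℝ]) (i : Fin m) : (mat (consRow r Z) *ᵥ v) i.succ = (mat Z *ᵥ v) i := rfl

lemma gaussianArray_column {m n : ℕ} {S : Set (Fin m × Fin (n + 1) → ℍ[ℝ])}
    (hS : MeasurableSet S) :
    gaussianArray (Fin m × Fin (n + 1)) S =
      ∫⁻ x, gaussianArray (Fin m × Fin n) {Y | consColumn x Y ∈ S} ∂(gaussianArray (Fin m)) := by
  have h := measurePreserving_sumElim (splitColumn m n)
  rw [← h.measure_preimage hS.nullMeasurableSet, Measure.prod_apply (h.measurable hS)]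
  rfl

lemma gaussianArray_row {m n : ℕ} {S : Set (Fin (m + 1) × Fin n → ℍ[ℝ])}
    (hS : MeasurableSet S) :
    gaussianArray (Fin (m + 1) × Fin n) S =
      ∫⁻ r, gaussianArray (Fin m × Fin n) {Z | consRow r Z ∈ S} ∂(gaussianArray (Fin n)) := by
  have h := measurePreserving_sumElim (splitRow m n)
  rw [← h.measure_preimage hS.nullMeasurableSet, Measure.prod_apply (h.measurable hS)]
  rfl

lemma measurable_consColumn {m n : ℕ} (x : Fin m → ℍ[ℝ]) :
    Measurable (consColumn (n := n) x) :=
  (measurePreserving_sumElim (splitColumn m n)).measurable.comp measurable_prodMk_left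

lemma measurable_consRow {m n : ℕ} (r : Fin n → ℍ[ℝ]) :
    Measurable (consRow (m := m) r) :=
  (measurePreserving_sumElim (splitRow m n)).measurable.comp measurable_prodMk_left

/-- The quadratic form `u |v₀|² + t (|v₁|² + ⋯ + |vₙ|²)`. -/
noncomputable def diagForm {n : ℕ} (u t : ℝ) (v : Fin (n + 1) → ℍ[ℝ]) : ℝ :=
  u * ‖v 0‖ ^ 2 + t * nsq fun i => v (Fin.succ i)

lemma diagForm_self {n : ℕ} (t : ℝ) (v : Fin (n + 1) → ℍ[ℝ]) : diagForm t t v = t * nsq v := by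
  rw [diagForm, nsq, nsq, Fin.sum_univ_succ]; ring

/-- For `σ = 1` the arrays with `X† X ≥ diag (u, t, …, t)`, for `σ = -1` the arrays with
`X† X ≤ diag (u, t, …, t)`. -/
def formSet (σ : ℝ) (n : ℕ) (u t : ℝ) : Set (Fin (n + 1) × Fin (n + 1) → ℍ[ℝ]) :=
  {X | ∀ v, 0 ≤ σ * (nsq (mat X *ᵥ v) - diagForm u t v)}

lemma measurableSet_formSet (σ : ℝ) (n : ℕ) (u t : ℝ) : MeasurableSet (formSet σ n u t) := by
  refine IsClosed.measurableSet ?_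
  rw [formSet, ofPred_forall]
  refine isClosed_iInter fun v => ?_
  refine isClosed_le continuous_const ?_
  unfold nsq mat Matrix.mulVec dotProduct
  simp only [Matrix.of_apply]
  fun_prop

/-- The probability that `X† X - diag (u, t, …, t)` is positive semidefinite (`σ = 1`), or negative
semidefinite (`σ = -1`), for the quaternion Ginibre matrix `X` of size `n + 1`. -/
noncomputable def formProb (σ : ℝ) (n : ℕ) (u t : ℝ) : ℝ≥0∞ :=
  gaussianArray (Fin (n + 1) × Fin (n + 1)) (formSet σ n u t)

/-- The first column can be rotated to a multiple of the first basis vector. -/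
lemma gaussianArray_consColumn_formSet (σ : ℝ) (n : ℕ) (u t : ℝ) (x : Fin (n + 1) → ℍ[ℝ]) :
    gaussianArray (Fin (n + 1) × Fin n) {Y | consColumn x Y ∈ formSet σ n u t} =
      gaussianArray (Fin (n + 1) × Fin n)
        {Y | consColumn (Pi.single 0 ((√(nsq x) : ℝ) : ℍ[ℝ])) Y ∈ formSet σ n u t} := by
  obtain ⟨U, hU, -, hx⟩ := exists_unitary_mulVec_eq_single x
  have hm : MeasurableSet
      {Y | consColumn (n := n) (Pi.single 0 ((√(nsq x) : ℝ) : ℍ[ℝ])) Y ∈ formSet σ n u t} :=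
    measurable_consColumn _ (measurableSet_formSet σ n u t)
  rw [← (measurePreserving_unitary_mul (κ := Fin n) hU).measure_preimage hm.nullMeasurableSet]
  congr 1
  ext Y
  simp only [mem_ofPred_eq, mem_preimage, formSet]
  refine forall_congr' fun v => ?_
  have : mat (consColumn (Pi.single 0 ((√(nsq x) : ℝ) : ℍ[ℝ])) fun p => (U * mat Y) p.1 p.2) *ᵥ v =
      U *ᵥ (mat (consColumn x Y) *ᵥ v) := by
    rw [mat_consColumn_mulVec, mat_consColumn_mulVec, ← hx]
    have h1 : mat (fun p : Fin (n + 1) × Fin n => (U * mat Y) p.1 p.2) = U * mat Y := rfl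
    have h2 : (fun i => x i * v 0 + (mat Y *ᵥ fun j => v j.succ) i) =
      (fun i => x i * v 0) + (mat Y *ᵥ fun j => v j.succ) := rfl
    rw [h1, h2, Matrix.mulVec_add, Matrix.mulVec_mulVec]
    ext1 i
    simp only [Pi.add_apply]
    congr 1
    simp only [Matrix.mulVec, dotProduct, Finset.sum_mul, mul_assoc]
  rw [this, nsq_mulVec hU]

/-- Membership in `formSet` of a matrix whose first column is `(d, 0, …, 0)`. -/
lemma consColumn_single_mem_formSet {σ : ℝ} {n : ℕ} {u t : ℝ} {d : ℝ} {r : Fin (n + 1) → ℍ[ℝ]}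
    {Z : Fin (n + 1) × Fin (n + 1) → ℍ[ℝ]} :
    consColumn (Pi.single 0 (d : ℍ[ℝ])) (consRow r Z) ∈ formSet σ (n + 1) u t ↔
      ∀ (a : ℍ[ℝ]) (w : Fin (n + 1) → ℍ[ℝ]), 0 ≤ σ * (‖d * a + r ⬝ᵥ w‖ ^ 2 + nsq (mat Z *ᵥ w) -
        (u * ‖a‖ ^ 2 + t * nsq w)) := by
  have key : ∀ v : Fin (n + 2) → ℍ[ℝ],
      nsq (mat (consColumn (Pi.single 0 (d : ℍ[ℝ])) (consRow r Z)) *ᵥ v) =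
      ‖d * v 0 + r ⬝ᵥ fun j => v (Fin.succ j)‖ ^ 2 + nsq (mat Z *ᵥ fun j => v (Fin.succ j)) := by
    intro v
    rw [mat_consColumn_mulVec, nsq, Fin.sum_univ_succ, mat_consRow_mulVec_zero]
    simp only [Pi.single_eq_same, mat_consRow_mulVec_succ]
    congr 1
    refine Finset.sum_congr rfl fun i _ => ?_
    rw [Pi.single_eq_of_ne (Fin.succ_ne_zero i), zero_mul, zero_add]
  constructor
  · intro h a w
    have := h (Fin.cons a w)
    rw [key] at this
    simpa [diagForm] using this
  · intro h v
    rw [key]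
    exact h (v 0) fun j => v (Fin.succ j)

/-- The rest of the first row can be rotated to a multiple of the first basis vector. -/
lemma gaussianArray_consRow_formSet (σ : ℝ) (n : ℕ) (u t d : ℝ) (r : Fin (n + 1) → ℍ[ℝ]) :
    gaussianArray (Fin (n + 1) × Fin (n + 1))
        {Z | consColumn (Pi.single 0 (d : ℍ[ℝ])) (consRow r Z) ∈ formSet σ (n + 1) u t} =
      gaussianArray (Fin (n + 1) × Fin (n + 1))
        {Z | consColumn (Pi.single 0 (d : ℍ[ℝ]))
          (consRow (Pi.single 0 ((√(nsq r) : ℝ) : ℍ[ℝ])) Z) ∈ formSet σ (n + 1) u t} := by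
  obtain ⟨U, hU, hU', hx⟩ := exists_unitary_mulVec_eq_single (star r)
  have hr : r ᵥ* Uᴴ = Pi.single 0 ((√(nsq r) : ℝ) : ℍ[ℝ]) := by
    have := congrArg star hx
    rw [Matrix.star_mulVec, star_star, nsq_star, ← Pi.single_star, Quaternion.star_coe] at this
    exact this
  have hm : MeasurableSet {Z | consColumn (Pi.single 0 (d : ℍ[ℝ]))
      (consRow (Pi.single 0 ((√(nsq r) : ℝ) : ℍ[ℝ])) Z) ∈ formSet σ (n + 1) u t} :=
    measurable_consRow _ (measurable_consColumn _ (measurableSet_formSet σ (n + 1) u t))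
  have hV : Uᴴ * Uᴴᴴ = 1 := by rwa [Matrix.conjTranspose_conjTranspose]
  rw [← (measurePreserving_mul_unitary (ι := Fin (n + 1)) hV).measure_preimage
    hm.nullMeasurableSet]
  congr 1
  ext Z
  simp only [mem_ofPred_eq, mem_preimage, consColumn_single_mem_formSet]
  refine forall_congr' fun a => ?_
  have h1 : mat (fun p : Fin (n + 1) × Fin (n + 1) => (mat Z * Uᴴ) p.1 p.2) = mat Z * Uᴴ := rfl
  rw [h1, ← hr]
  simp_rw [← Matrix.mulVec_mulVec, ← Matrix.dotProduct_mulVec]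
  constructor
  · intro h w
    have := h (Uᴴ *ᵥ w)
    rwa [nsq_mulVec (U := Uᴴ) (by rwa [Matrix.conjTranspose_conjTranspose])] at this
  · intro h w
    have := h (U *ᵥ w)
    rwa [Matrix.mulVec_mulVec, hU, Matrix.one_mulVec, nsq_mulVec hU] at this

end GinSE

/-! ### Schur complements and the recursion -/

namespace GinSE

open Quaternion Set

/-- Completing the square in the first variable. -/
lemma norm_sq_sub_eq_complete_square {Q E u : ℝ} (hQ : 0 ≤ Q) (hE : 0 ≤ E) (hu : Q - u ≠ 0)
    (a b : ℍ[ℝ]) :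
    ‖((√Q : ℝ) : ℍ[ℝ]) * a + ((√E : ℝ) : ℍ[ℝ]) * b‖ ^ 2 - u * ‖a‖ ^ 2 =
      (Q - u) * ‖a + (√Q * √E / (Q - u)) • b‖ ^ 2 - u * E / (Q - u) * ‖b‖ ^ 2 := by
  rw [Quaternion.coe_mul_eq_smul, Quaternion.coe_mul_eq_smul, norm_add_sq_real, norm_add_sq_real]
  simp only [norm_smul, inner_smul_left, inner_smul_right, mul_pow, Real.norm_eq_abs, sq_abs,
    Real.sq_sqrt hQ, Real.sq_sqrt hE, div_pow, RCLike.conj_to_real]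
  field_simp
  ring

/-- A Schur complement: one step of the elimination for a bidiagonal matrix. -/
lemma consColumn_consRow_mem_formSet_iff {σ : ℝ} {n : ℕ} {u t Q E : ℝ} (hQ : 0 ≤ Q) (hE : 0 ≤ E)
    (hσ : 0 < σ * (Q - u)) {Z : Fin (n + 1) × Fin (n + 1) → ℍ[ℝ]} :
    consColumn (Pi.single 0 ((√Q : ℝ) : ℍ[ℝ])) (consRow (Pi.single 0 ((√E : ℝ) : ℍ[ℝ])) Z) ∈
      formSet σ (n + 1) u t ↔ Z ∈ formSet σ n (t + u * E / (Q - u)) t := by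
  have hne : Q - u ≠ 0 := by rintro h; simp [h] at hσ
  rw [consColumn_single_mem_formSet]
  have key : ∀ (a : ℍ[ℝ]) (w : Fin (n + 1) → ℍ[ℝ]),
      σ * (‖((√Q : ℝ) : ℍ[ℝ]) * a + Pi.single 0 ((√E : ℝ) : ℍ[ℝ]) ⬝ᵥ w‖ ^ 2 + nsq (mat Z *ᵥ w) -
        (u * ‖a‖ ^ 2 + t * nsq w)) =
      σ * (Q - u) * ‖a + (√Q * √E / (Q - u)) • w 0‖ ^ 2 +
        σ * (nsq (mat Z *ᵥ w) - diagForm (t + u * E / (Q - u)) t w) := by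
    intro a w
    have h := norm_sq_sub_eq_complete_square hQ hE hne a (w 0)
    have h2 : nsq w = ‖w 0‖ ^ 2 + nsq fun i => w (Fin.succ i) := by
      rw [nsq, nsq, Fin.sum_univ_succ]
    rw [single_dotProduct, diagForm, h2]
    linear_combination σ * h
  simp_rw [key]
  constructor
  · intro h w
    have := h (-((√Q * √E / (Q - u)) • w 0)) w
    simpa using this
  · intro h a w
    exact add_nonneg (mul_nonneg hσ.le (by positivity)) (h w)

lemma consColumn_notMem_formSet {σ : ℝ} {n : ℕ} {u t Q : ℝ} (hQ : 0 ≤ Q)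
    (hσ : σ * (Q - u) < 0) {r : Fin (n + 1) → ℍ[ℝ]} {Z : Fin (n + 1) × Fin (n + 1) → ℍ[ℝ]} :
    consColumn (Pi.single 0 ((√Q : ℝ) : ℍ[ℝ])) (consRow r Z) ∉ formSet σ (n + 1) u t := by
  rw [consColumn_single_mem_formSet]
  intro h
  have := h 1 0
  have h0 : nsq (0 : Fin (n + 1) → ℍ[ℝ]) = 0 := nsq_eq_zero.2 rfl
  simp [h0, Real.sq_sqrt hQ] at this
  linarith

lemma lintegral_nsq_eq_lintegral_radial {k : ℕ} {F : ℝ → ℝ≥0∞} (hF : Measurable F) :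
    ∫⁻ x, F (nsq x) ∂(gaussianArray (Fin (k + 1))) = ∫⁻ Q, F Q ∂(radial k) := by
  rw [← map_nsq_gaussianArray, lintegral_map hF measurable_nsq]

lemma measurable_single_sqrt {m : ℕ} :
    Measurable fun Q : ℝ => (Pi.single 0 ((√Q : ℝ) : ℍ[ℝ]) : Fin (m + 1) → ℍ[ℝ]) := by
  refine measurable_pi_lambda _ fun i => ?_
  by_cases h : i = 0
  · subst h
    simp only [Pi.single_eq_same]
    exact (Quaternion.continuous_coe.comp Real.continuous_sqrt).measurable
  · simp only [Pi.single_eq_of_ne h]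
    exact measurable_const

/-- The recursion for `formProb` given by one step of the bidiagonalization of a Gaussian matrix:
the first column and then the rest of the first row are rotated to multiples of the first basis
vector. Their squared lengths `Q` and `E` are independent and gamma distributed, and the remaining
block is again Gaussian. -/
theorem formProb_succ (σ : ℝ) (hσ : σ ≠ 0) (n : ℕ) (u t : ℝ) :
    formProb σ (n + 1) u t = ∫⁻ Q, ∫⁻ E, (if 0 < σ * (Q - u) then
      formProb σ n (t + u * E / (Q - u)) t else 0) ∂(radial n) ∂(radial (n + 1)) := by
  have hS := measurableSet_formSet σ (n + 1) u t
  rw [formProb, gaussianArray_column hS]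
  rw [lintegral_congr (gaussianArray_consColumn_formSet σ (n + 1) u t)]
  rw [lintegral_nsq_eq_lintegral_radial
    (F := fun Q => gaussianArray (Fin (n + 2) × Fin (n + 1))
      {Y | consColumn (Pi.single 0 ((√Q : ℝ) : ℍ[ℝ])) Y ∈ formSet σ (n + 1) u t})]
  swap
  · have hm : Measurable fun z : ℝ × (Fin (n + 2) × Fin (n + 1) → ℍ[ℝ]) =>
        consColumn (Pi.single 0 ((√z.1 : ℝ) : ℍ[ℝ])) z.2 :=
      (measurePreserving_sumElim (splitColumn (n + 2) (n + 1))).measurable.comp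
        ((measurable_single_sqrt.comp measurable_fst).prodMk measurable_snd)
    exact measurable_measure_prodMk_left (hm hS)
  refine lintegral_congr_ae ?_
  filter_upwards [ae_radial_pos (n + 1),
    compl_mem_ae_iff.2 (measure_singleton (μ := radial (n + 1)) u)] with Q hQ hQu
  have hQu : Q ≠ u := hQu
  have hSQ : MeasurableSet {Y | consColumn (n := n + 1) (Pi.single 0 ((√Q : ℝ) : ℍ[ℝ])) Y ∈
      formSet σ (n + 1) u t} := measurable_consColumn _ hS
  rw [gaussianArray_row hSQ]
  simp_rw [mem_ofPred_eq]
  rw [lintegral_congr (gaussianArray_consRow_formSet σ n u t √Q)]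
  rw [lintegral_nsq_eq_lintegral_radial
    (F := fun E => gaussianArray (Fin (n + 1) × Fin (n + 1))
      {Z | consColumn (Pi.single 0 ((√Q : ℝ) : ℍ[ℝ])) (consRow (Pi.single 0 ((√E : ℝ) : ℍ[ℝ])) Z) ∈
        formSet σ (n + 1) u t})]
  swap
  · have hm : Measurable fun z : ℝ × (Fin (n + 1) × Fin (n + 1) → ℍ[ℝ]) =>
        consRow (Pi.single 0 ((√z.1 : ℝ) : ℍ[ℝ])) z.2 :=
      (measurePreserving_sumElim (splitRow (n + 1) (n + 1))).measurable.comp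
        ((measurable_single_sqrt.comp measurable_fst).prodMk measurable_snd)
    exact measurable_measure_prodMk_left
      (((measurable_consColumn (Pi.single 0 ((√Q : ℝ) : ℍ[ℝ]))).comp hm) hS)
  refine lintegral_congr_ae ?_
  filter_upwards [ae_radial_pos n] with E hE
  split_ifs with h
  · simp_rw [consColumn_consRow_mem_formSet_iff hQ.le hE.le h]
    rfl
  · have h' : σ * (Q - u) < 0 :=
      lt_of_le_of_ne (not_lt.1 h) (mul_ne_zero hσ (sub_ne_zero.2 hQu))
    simp [consColumn_notMem_formSet hQ.le h']

lemma formProb_zero (σ u t : ℝ) :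
    formProb σ 0 u t = radial 0 {Q | 0 ≤ σ * (Q - u)} := by
  have hm : MeasurableSet {Q : ℝ | 0 ≤ σ * (Q - u)} :=
    measurableSet_le measurable_const (by fun_prop)
  rw [formProb, gaussianArray_column (measurableSet_formSet σ 0 u t), ← map_nsq_gaussianArray,
    Measure.map_apply measurable_nsq hm, ← lintegral_indicator_one (measurable_nsq hm)]
  refine lintegral_congr fun x => ?_
  have key : ∀ Y : Fin 1 × Fin 0 → ℍ[ℝ], consColumn x Y ∈ formSet σ 0 u t ↔
      0 ≤ σ * (nsq x - u) := by
    intro Y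
    have : ∀ v : Fin 1 → ℍ[ℝ], σ * (nsq (mat (consColumn x Y) *ᵥ v) - diagForm u t v) =
        σ * (nsq x - u) * ‖v 0‖ ^ 2 := by
      intro v
      rw [mat_consColumn_mulVec]
      simp [nsq, diagForm, mul_pow, Matrix.mulVec, dotProduct]
      ring
    simp only [formSet, mem_ofPred_eq, this]
    constructor
    · intro h; simpa using h 1
    · intro h v; exact mul_nonneg h (by positivity)
  simp_rw [key]
  by_cases h : 0 ≤ σ * (nsq x - u)
  · rw [indicator_of_mem (by exact h)]
    simp [h]
  · rw [indicator_of_notMem (by exact h)]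
    simp [h]

end GinSE

/-! ### The exact smallest singular value distribution -/

namespace GinSE

open Set

lemma lintegral_radial_ofReal (k : ℕ) {f : ℝ → ℝ}
    (hf : ∀ x, 0 < x → 0 ≤ f x)
    (hi : IntegrableOn (fun x => (x ^ (2 * k + 1) * Real.exp (-2 * x)) * f x) (Ioi 0)) :
    ∫⁻ x, ENNReal.ofReal (f x) ∂(radial k) = ENNReal.ofReal ((2 : ℝ) ^ (2 * k + 2) / (2 * k + 1)! *
      ∫ x in Ioi 0, (x ^ (2 * k + 1) * Real.exp (-2 * x)) * f x) := by
  have hint : Integrable f (radial k) := by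
    rw [radial, gammaMeasure, integrable_withDensity_iff_integrable_smul' (by
      unfold gammaPDF; have := measurable_gammaPDFReal (2 * k + 2) 2; fun_prop)
      (by simp [gammaPDF])]
    have h0 := (integrable_indicator_iff measurableSet_Ioi).2
      (hi.const_mul ((2 : ℝ) ^ (2 * k + 2) / (2 * k + 1)!))
    refine h0.congr ?_
    filter_upwards [compl_mem_ae_iff.2 (measure_singleton (0 : ℝ))] with x hx
    have hx : x ≠ 0 := hx
    rw [gammaPDF, ENNReal.toReal_ofReal (gammaPDFReal_nonneg (by positivity) two_pos x),
      gammaPDFReal]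
    rcases lt_or_gt_of_ne hx with h | h
    · simp [h.not_ge, h.le]
    · rw [if_pos h.le, indicator_of_mem (by exact h), smul_eq_mul]
      have e1 : (2 * k + 2 : ℝ) = ((2 * k + 1 : ℕ) : ℝ) + 1 := by push_cast; ring
      rw [e1, Real.Gamma_nat_eq_factorial, add_sub_cancel_right, Real.rpow_natCast,
        ← Nat.cast_succ, Real.rpow_natCast]
      simp only [Nat.succ_eq_add_one]
      ring_nf
  rw [← ofReal_integral_eq_lintegral_ofReal hint
    ((ae_radial_pos k).mono fun x hx => hf x hx), integral_radial]
  simp_rw [smul_eq_mul, mul_assoc]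
  rw [integral_const_mul]

/-- The coefficients `(a n, b n)` of the polynomial `a n + b n * u` in `formProb_one_eq`, defined by
the linear recursion that `formProb_succ` induces on them. Their closed form is
`gapCoeff_eq_sum`. -/
noncomputable def gapCoeff (s : ℝ) : ℕ → ℝ × ℝ
  | 0 => (1, 2)
  | n + 1 =>
    let a := (gapCoeff s n).1 + s * (gapCoeff s n).2
    (a, (a + (n + 1) * (gapCoeff s n).2) / (n + 3 / 2))

lemma gapCoeff_nonneg {s : ℝ} (hs : 0 ≤ s) (n : ℕ) :
    0 ≤ (gapCoeff s n).1 ∧ 0 ≤ (gapCoeff s n).2 := by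
  induction n with
  | zero => simp [gapCoeff]
  | succ n ih =>
    obtain ⟨h1, h2⟩ := ih
    have : 0 ≤ (gapCoeff s n).1 + s * (gapCoeff s n).2 := by positivity
    refine ⟨this, ?_⟩
    simp only [gapCoeff]
    positivity

/-- The integral over `E` in `formProb_succ`, for `formProb 1 n` of the form in
`formProb_one_eq`. -/
lemma lintegral_radial_exp_mul_affine (n : ℕ) {c A B : ℝ} (hc : 0 < 1 + c) (hA : 0 ≤ A)
    (hB : 0 ≤ B) :
    ∫⁻ E, ENNReal.ofReal (Real.exp (-2 * c * E) * (A + B * E)) ∂(radial n) =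
      ENNReal.ofReal (A / (1 + c) ^ (2 * n + 2) + B * (n + 1) / (1 + c) ^ (2 * n + 3)) := by
  have hb : 0 < 2 * (1 + c) := by positivity
  have he : ∀ x : ℝ, x ^ (2 * n + 1) * Real.exp (-2 * x) * (Real.exp (-2 * c * x) * (A + B * x)) =
      A * (x ^ (2 * n + 1) * Real.exp (-(2 * (1 + c)) * x)) +
        B * (x ^ (2 * n + 2) * Real.exp (-(2 * (1 + c)) * x)) := by
    intro x
    rw [show -(2 * (1 + c)) * x = -2 * x + -2 * c * x by ring, Real.exp_add]
    ring
  have i1 := (integrableOn_pow_mul_exp (2 * n + 1) hb).const_mul A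
  have i2 := (integrableOn_pow_mul_exp (2 * n + 2) hb).const_mul B
  rw [lintegral_radial_ofReal n (fun x hx => by positivity)]
  · simp_rw [he]
    rw [integral_add i1 i2, integral_const_mul, integral_const_mul, integral_pow_mul_exp _ hb,
      integral_pow_mul_exp _ hb]
    congr 1
    have h1 : ((2 * n + 2)! : ℝ) = (2 * n + 2) * (2 * n + 1)! := by
      rw [Nat.factorial_succ]; push_cast; ring
    have h0 : ((2 * n + 1)! : ℝ) ≠ 0 := by exact_mod_cast Nat.factorial_ne_zero _
    have h3 : (1 + c) ≠ 0 := by positivity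
    rw [h1, mul_pow, mul_pow]
    field_simp
    ring
  · exact (i1.add i2).congr (ae_of_all _ fun x => (he x).symm)

/-- The integral over `Q` in `formProb_succ`, for `formProb 1 n` of the form in `formProb_one_eq`:
the power of `Q` in the denominator cancels against the gamma density, and the shift `Q ↦ Q + u`
leaves elementary gamma integrals. -/
lemma lintegral_radial_Ioi (k : ℕ) {u A B : ℝ} (hu : 0 ≤ u) (hA : 0 ≤ A) (hB : 0 ≤ B) :
    ∫⁻ Q, ENNReal.ofReal (if u < Q then ((Q - u) / Q) ^ (2 * k) * (A + B / Q) else 0)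
        ∂(radial k) =
      ENNReal.ofReal (Real.exp (-2 * u) * (A + (A * u + B) / (k + 1 / 2))) := by
  set f : ℝ → ℝ := fun Q => if u < Q then ((Q - u) / Q) ^ (2 * k) * (A + B / Q) else 0 with hf
  set g : ℝ → ℝ := fun x => Real.exp (-2 * u) * (A * (x ^ (2 * k + 1) * Real.exp (-2 * x)) +
    (A * u + B) * (x ^ (2 * k) * Real.exp (-2 * x))) with hg
  have i1 := (integrableOn_pow_mul_exp (2 * k + 1) two_pos).const_mul A
  have i2 := (integrableOn_pow_mul_exp (2 * k) two_pos).const_mul (A * u + B)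
  have hgi : IntegrableOn g (Ioi 0) := (i1.add i2).const_mul _
  have he : ∀ x, 0 < x → x ^ (2 * k + 1) * Real.exp (-2 * x) * f x =
      (Ioi u).indicator (fun x => g (x - u)) x := by
    intro x hx
    by_cases h : u < x
    · rw [indicator_of_mem (by exact h)]
      simp only [hf, hg, if_pos h]
      rw [show -2 * (x - u) = -2 * x + 2 * u by ring, Real.exp_add,
        show -2 * u = -(2 * u) by ring, Real.exp_neg, div_pow]
      field_simp
      ring
    · rw [indicator_of_notMem (by exact h)]
      simp [hf, h]
  have hsub : Ioi u ⊆ Ioi (0 : ℝ) := Ioi_subset_Ioi hu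
  have hpre : (fun x : ℝ => x - u) ⁻¹' Ioi 0 = Ioi u := by ext; simp
  have hmp := measurePreserving_sub_right (volume : Measure ℝ) u
  have hme := (MeasurableEquiv.subRight u).measurableEmbedding
  have hgi' : IntegrableOn (fun x => g (x - u)) (Ioi u) := by
    rw [← hpre]
    exact (hmp.integrableOn_comp_preimage hme).2 hgi
  have hgI : ∫ x in Ioi u, g (x - u) = ∫ x in Ioi 0, g x := by
    rw [← hpre]
    exact hmp.setIntegral_preimage_emb hme g (Ioi 0)
  have hf0 : ∀ x, 0 < x → 0 ≤ f x := by
    intro x hx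
    simp only [hf]
    split_ifs with h
    · have := sub_pos.2 h
      positivity
    · exact le_rfl
  rw [lintegral_radial_ofReal k hf0]
  · rw [setIntegral_congr_fun measurableSet_Ioi (fun x hx => he x hx),
      setIntegral_indicator measurableSet_Ioi, inter_eq_right.2 hsub, hgI]
    simp only [hg]
    rw [integral_const_mul, integral_add i1 i2, integral_const_mul, integral_const_mul,
      integral_pow_mul_exp _ two_pos, integral_pow_mul_exp _ two_pos]
    congr 1
    have h1 : ((2 * k + 1)! : ℝ) = (2 * k + 1) * (2 * k)! := by
      rw [Nat.factorial_succ]; push_cast; ring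
    have h0 : ((2 * k)! : ℝ) ≠ 0 := by exact_mod_cast Nat.factorial_ne_zero _
    rw [h1]
    field_simp
    ring
  · refine IntegrableOn.congr_fun ?_ (fun x hx => (he x hx).symm) measurableSet_Ioi
    exact ((integrable_indicator_iff measurableSet_Ioi).2 hgi').integrableOn

/-- The probability that `X† X ≥ diag (u, s, …, s)`, in closed form: the recursion `formProb_succ`
preserves affine functions of `u` times `exp (-2 u)`, as the integral over `E` produces the factor
`((Q - u) / Q) ^ (2 n + 2)` that makes the integral over `Q` elementary. -/
theorem formProb_one_eq {s : ℝ} (hs : 0 ≤ s) (n : ℕ) {u : ℝ} (hu : 0 ≤ u) :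
    formProb 1 n u s = ENNReal.ofReal (Real.exp (-2 * u - 2 * n * s) *
      ((gapCoeff s n).1 + (gapCoeff s n).2 * u)) := by
  induction n generalizing u with
  | zero =>
    rw [formProb_zero]
    have hset : {Q : ℝ | 0 ≤ 1 * (Q - u)} = Ici u := by ext; simp
    have h := lintegral_radial_Ioi 0 hu zero_le_one le_rfl
    have hind : ∀ Q : ℝ,
        ENNReal.ofReal (if u < Q then ((Q - u) / Q) ^ (2 * 0) * (1 + 0 / Q) else 0) =
        (Ioi u).indicator 1 Q := by
      intro Q
      by_cases hQ : u < Q <;> simp [hQ]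
    simp_rw [hind] at h
    rw [lintegral_indicator_one measurableSet_Ioi] at h
    rw [hset, ← measure_congr Ioi_ae_eq_Ici, h]
    congr 1
    simp only [gapCoeff]
    push_cast
    ring_nf
  | succ n ih =>
    set a := (gapCoeff s n).1
    set b := (gapCoeff s n).2
    obtain ⟨ha, hb⟩ : 0 ≤ a ∧ 0 ≤ b := gapCoeff_nonneg hs n
    rw [formProb_succ 1 one_ne_zero]
    have inner : ∀ Q : ℝ, ∫⁻ E, (if 0 < 1 * (Q - u) then
        formProb 1 n (s + u * E / (Q - u)) s else 0) ∂(radial n) =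
        ENNReal.ofReal (Real.exp (-2 * (n + 1) * s)) * ENNReal.ofReal (if u < Q then
          ((Q - u) / Q) ^ (2 * (n + 1)) * ((a + s * b) + ((n + 1) * b * u) / Q) else 0) := by
      intro Q
      by_cases h : u < Q
      · have hQ : 0 < Q := hu.trans_lt h
        have hd : 0 < Q - u := sub_pos.2 h
        simp only [one_mul, hd, if_true, h]
        have hc : 0 ≤ u / (Q - u) := by positivity
        have hsb : 0 ≤ a + s * b := by positivity
        rw [lintegral_congr_ae (g := fun E => ENNReal.ofReal (Real.exp (-2 * (n + 1) * s)) *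
          ENNReal.ofReal (Real.exp (-2 * (u / (Q - u)) * E) *
            ((a + s * b) + (b * (u / (Q - u))) * E)))]
        · rw [lintegral_const_mul _ (by fun_prop),
            lintegral_radial_exp_mul_affine n (by positivity) hsb (by positivity)]
          congr 2
          -- the rate of the gamma law of `E` is multiplied by `1 + u / (Q - u)`
          have h1 : 1 + u / (Q - u) = Q / (Q - u) := by field_simp; ring
          rw [h1, div_pow, div_pow, div_pow]
          field_simp
          ring
        · filter_upwards [ae_radial_pos n] with E hE
          rw [ih (by positivity), ← ENNReal.ofReal_mul (by positivity), ← mul_assoc,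
            ← Real.exp_add]
          congr 2
          · ring_nf
          · ring
      · have hd : ¬ 0 < Q - u := by simpa using h
        simp [h, hd]
    rw [lintegral_congr inner, lintegral_const_mul, lintegral_radial_Ioi (n + 1) hu (by positivity)
      (by positivity), ← ENNReal.ofReal_mul (by positivity), ← mul_assoc, ← Real.exp_add]
    · congr 2
      · push_cast; ring_nf
      · simp only [gapCoeff]
        change _ = (a + s * b) + (a + s * b + (n + 1) * b) / (n + 3 / 2) * u
        push_cast
        field_simp
        ring
    · exact (Measurable.ite measurableSet_Ioi (by fun_prop) measurable_const).ennreal_ofReal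

end GinSE

/-! ### The hard edge limit -/

namespace GinSE

open Set

/-- The Pochhammer symbol `(1/2)_k`. -/
noncomputable abbrev halfPoch (k : ℕ) : ℝ := (ascPochhammer ℝ k).eval (1 / 2)

lemma halfPoch_pos (k : ℕ) : 0 < halfPoch k := ascPochhammer_pos k _ (by norm_num)

lemma halfPoch_succ (k : ℕ) : halfPoch (k + 1) = halfPoch k * (1 / 2 + k) :=
  ascPochhammer_succ_eval k _

lemma halfPoch_mul_factorial (k : ℕ) : halfPoch k * k ! = (2 * k)! / 4 ^ k := by
  induction k with
  | zero => simp [halfPoch]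
  | succ k ih =>
    rw [halfPoch_succ, Nat.factorial_succ, show 2 * (k + 1) = 2 * k + 1 + 1 by ring,
      Nat.factorial_succ, Nat.factorial_succ]
    push_cast
    field_simp at ih ⊢
    linear_combination 4 * (k + 1) * (2 * k + 1) * ih

/-- Both closed forms follow by induction from Pascal's rule and
`(n + 1) C(n, k) = (n + 1 - k) C(n + 1, k)`. -/
lemma gapCoeff_eq_sum (s : ℝ) (n : ℕ) :
    (gapCoeff s n).1 = ∑ k ∈ Finset.range (n + 1), n.choose k * s ^ k / halfPoch k ∧
      (gapCoeff s n).2 = ∑ k ∈ Finset.range (n + 1), n.choose k * s ^ k / halfPoch (k + 1) := by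
  induction n with
  | zero => simp [gapCoeff, halfPoch]
  | succ n ih =>
    obtain ⟨iha, ihb⟩ := ih
    have ha : (gapCoeff s n).1 + s * (gapCoeff s n).2 =
        ∑ k ∈ Finset.range (n + 2), (n + 1).choose k * s ^ k / halfPoch k := by
      rw [Finset.sum_range_succ', iha, ihb, Finset.mul_sum]
      have h1 : ∑ k ∈ Finset.range (n + 1), (n.choose k : ℝ) * s ^ k / halfPoch k =
          ∑ k ∈ Finset.range (n + 1), (n.choose (k + 1) : ℝ) * s ^ (k + 1) / halfPoch (k + 1) +
            1 := by
        rw [Finset.sum_range_succ', Finset.sum_range_succ _ n]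
        simp [halfPoch]
      rw [h1, add_right_comm, ← Finset.sum_add_distrib]
      congr 1
      · refine Finset.sum_congr rfl fun k _ => ?_
        rw [Nat.choose_succ_succ]
        push_cast
        ring
      · simp [halfPoch]
    refine ⟨ha, ?_⟩
    simp only [gapCoeff]
    -- the vanishing term `k = n + 1` lets both sums range over the same indices
    have hz : ∑ k ∈ Finset.range (n + 1), (n.choose k : ℝ) * s ^ k / halfPoch (k + 1) =
        ∑ k ∈ Finset.range (n + 2), (n.choose k : ℝ) * s ^ k / halfPoch (k + 1) := by
      rw [Finset.sum_range_succ _ (n + 1)]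
      simp
    rw [ha, ihb, hz, Finset.mul_sum, ← Finset.sum_add_distrib, Finset.sum_div]
    refine Finset.sum_congr rfl fun k hk => ?_
    have hk : k ≤ n + 1 := Nat.lt_succ_iff.1 (Finset.mem_range.1 hk)
    have hc : (n.choose k : ℝ) * (n + 1) = (n + 1).choose k * (n + 1 - k) := by
      have := Nat.choose_mul_succ_eq n k
      rw [← Nat.cast_inj (R := ℝ)] at this
      push_cast [Nat.cast_sub hk] at this
      exact this
    have hp := (halfPoch_pos k).ne'
    rw [halfPoch_succ]
    field_simp
    linear_combination 2 * s ^ k * hc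

lemma hypergeometric0F1_half_term {x : ℝ} (hx : 0 ≤ x) (k : ℕ) :
    x ^ k / (halfPoch k * k !) = (2 * √x) ^ (2 * k) / (2 * k)! := by
  rw [halfPoch_mul_factorial, mul_pow, pow_mul √x, Real.sq_sqrt hx, pow_mul]
  norm_num
  field_simp

lemma hasSum_hypergeometric0F1_half {x : ℝ} (hx : 0 ≤ x) :
    HasSum (fun k : ℕ => x ^ k / (halfPoch k * k !)) (Real.cosh (2 * √x)) := by
  simp_rw [hypergeometric0F1_half_term hx]
  exact Real.hasSum_cosh _

lemma hypergeometric0F1_half {x : ℝ} (hx : 0 ≤ x) :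
    hypergeometric0F1 (1 / 2) x = Real.cosh (2 * √x) :=
  (hasSum_hypergeometric0F1_half hx).tsum_eq

/-- The probability `P(X† X ≥ s)` in closed form. -/
lemma formProb_one_self {s : ℝ} (hs : 0 ≤ s) (n : ℕ) :
    formProb 1 n s s =
      ENNReal.ofReal (Real.exp (-2 * (n + 1) * s) * (gapCoeff s (n + 1)).1) := by
  rw [formProb_one_eq hs n hs]
  congr 2
  · ring_nf
  · simp only [gapCoeff]; ring

lemma tendsto_gapCoeff {x : ℝ} (hx : 0 ≤ x) :
    Tendsto (fun N : ℕ => (gapCoeff (x / N) N).1) atTop (𝓝 (Real.cosh (2 * √x))) := by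
  have h1 : ∀ N : ℕ, (gapCoeff (x / N) N).1 =
      ∑' k : ℕ, (N.choose k : ℝ) * (x / N) ^ k / halfPoch k := by
    intro N
    rw [(gapCoeff_eq_sum _ N).1, tsum_eq_sum]
    intro k hk
    rw [Nat.choose_eq_zero_of_lt (by simpa using hk)]
    simp
  simp_rw [h1]
  rw [← (hasSum_hypergeometric0F1_half hx).tsum_eq]
  refine tendsto_tsum_of_dominated_convergence (hasSum_hypergeometric0F1_half hx).summable
    (fun k => ?_) ?_
  · have hr : Tendsto (fun N : ℕ => (N : ℝ) * (x / N)) atTop (𝓝 x) := by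
      refine tendsto_const_nhds.congr' ?_
      filter_upwards [eventually_gt_atTop 0] with N hN
      have : (0 : ℝ) < N := by exact_mod_cast hN
      field_simp
    have := (tendsto_choose_mul_pow_atTop k hr).div_const (halfPoch k)
    rwa [div_div, mul_comm (k ! : ℝ)] at this
  · filter_upwards [eventually_gt_atTop 0] with N hN k
    have hp := halfPoch_pos k
    have hN' : (0 : ℝ) < N := by exact_mod_cast hN
    rw [Real.norm_of_nonneg (by positivity), mul_comm (halfPoch k), ← div_div]
    gcongr
    have := Nat.choose_le_pow_div (α := ℝ) k N
    rw [div_pow]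
    calc (N.choose k : ℝ) * (x ^ k / N ^ k) ≤ N ^ k / k ! * (x ^ k / N ^ k) := by gcongr
      _ = x ^ k / k ! := by field_simp

/-- The hard edge limit: `P(X† X ≥ x / N) → exp (-2 x) cosh (2 √x)`. -/
theorem tendsto_formProb_one {x : ℝ} (hx : 0 ≤ x) :
    Tendsto (fun n : ℕ => (formProb 1 n (x / (n + 1 : ℕ)) (x / (n + 1 : ℕ))).toReal) atTop
      (𝓝 (Real.exp (-2 * x) * Real.cosh (2 * √x))) := by
  have h := ((tendsto_gapCoeff hx).comp (tendsto_add_atTop_nat 1)).const_mul (Real.exp (-2 * x))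
  refine h.congr fun n => ?_
  have hs : 0 ≤ x / (n + 1 : ℕ) := by positivity
  rw [formProb_one_self hs, ENNReal.toReal_ofReal
    (mul_nonneg (Real.exp_pos _).le (gapCoeff_nonneg hs _).1)]
  simp only [Function.comp_apply]
  congr 2
  push_cast
  field_simp

end GinSE

/-! ### The largest singular value -/

namespace GinSE

open Set

lemma lintegral_radial_exp (k : ℕ) {c : ℝ} (hc : 0 < 1 + c) :
    ∫⁻ E, ENNReal.ofReal (Real.exp (-2 * c * E)) ∂(radial k) =
      ENNReal.ofReal (1 / (1 + c) ^ (2 * k + 2)) := by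
  simpa using lintegral_radial_exp_mul_affine k hc zero_le_one le_rfl

/-- Chernoff bound for the upper tail of the gamma distribution. -/
lemma radial_Ici_le (k : ℕ) {c : ℝ} (hc0 : 0 ≤ c) (hc1 : c < 1) (K : ℝ) :
    radial k (Ici K) ≤ ENNReal.ofReal (Real.exp (-2 * c * K) / (1 - c) ^ (2 * k + 2)) := by
  have h1 : ∀ Q ∈ Ici K, 1 ≤ ENNReal.ofReal (Real.exp (-2 * c * K)) *
      ENNReal.ofReal (Real.exp (-2 * (-c) * Q)) := by
    intro Q hQ
    rw [← ENNReal.ofReal_mul (by positivity), ← Real.exp_add, ← ENNReal.ofReal_one]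
    refine ENNReal.ofReal_le_ofReal (Real.one_le_exp ?_)
    nlinarith [mul_nonneg hc0 (sub_nonneg.2 (mem_Ici.1 hQ))]
  calc radial k (Ici K) = ∫⁻ Q in Ici K, 1 ∂(radial k) := by simp
    _ ≤ ∫⁻ Q in Ici K, ENNReal.ofReal (Real.exp (-2 * c * K)) *
          ENNReal.ofReal (Real.exp (-2 * (-c) * Q)) ∂(radial k) :=
        setLIntegral_mono' measurableSet_Ici h1
    _ ≤ ∫⁻ Q, ENNReal.ofReal (Real.exp (-2 * c * K)) *
          ENNReal.ofReal (Real.exp (-2 * (-c) * Q)) ∂(radial k) := setLIntegral_le_lintegral _ _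
    _ = _ := by
        rw [lintegral_const_mul _ (by fun_prop), lintegral_radial_exp k (by linarith),
          ← ENNReal.ofReal_mul (by positivity), ← sub_eq_add_neg, mul_one_div]

/-- Chernoff bound for the lower tail of the gamma distribution. -/
lemma radial_Iic_le (k : ℕ) {c : ℝ} (hc0 : 0 ≤ c) (K : ℝ) :
    radial k (Iic K) ≤ ENNReal.ofReal (Real.exp (2 * c * K) / (1 + c) ^ (2 * k + 2)) := by
  have h1 : ∀ Q ∈ Iic K, 1 ≤ ENNReal.ofReal (Real.exp (2 * c * K)) *
      ENNReal.ofReal (Real.exp (-2 * c * Q)) := by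
    intro Q hQ
    rw [← ENNReal.ofReal_mul (by positivity), ← Real.exp_add, ← ENNReal.ofReal_one]
    refine ENNReal.ofReal_le_ofReal (Real.one_le_exp ?_)
    nlinarith [mul_nonneg hc0 (sub_nonneg.2 (mem_Iic.1 hQ))]
  calc radial k (Iic K) = ∫⁻ Q in Iic K, 1 ∂(radial k) := by simp
    _ ≤ ∫⁻ Q in Iic K, ENNReal.ofReal (Real.exp (2 * c * K)) *
          ENNReal.ofReal (Real.exp (-2 * c * Q)) ∂(radial k) :=
        setLIntegral_mono' measurableSet_Iic h1
    _ ≤ ∫⁻ Q, ENNReal.ofReal (Real.exp (2 * c * K)) *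
          ENNReal.ofReal (Real.exp (-2 * c * Q)) ∂(radial k) := setLIntegral_le_lintegral _ _
    _ = _ := by
        rw [lintegral_const_mul _ (by fun_prop), lintegral_radial_exp k (by linarith),
          ← ENNReal.ofReal_mul (by positivity), mul_one_div]

/-- If no squared length in the bidiagonal form exceeds `K`, then `X† X ≤ 4 K`: the recursion of
`formProb_succ` keeps the first parameter above `2 K`. -/
lemma one_le_formProb_neg_one_add {K : ℝ} (hK : 0 < K) {δ : ℝ≥0∞} (n : ℕ)
    (hδ : ∀ k ≤ n, radial k (Ici K) ≤ δ) {u : ℝ} (hu : 2 * K ≤ u) :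
    1 ≤ formProb (-1) n u (4 * K) + (2 * n + 1) * δ := by
  induction n generalizing u with
  | zero =>
    rw [formProb_zero]
    have huniv : (univ : Set ℝ) ⊆ {Q | 0 ≤ -1 * (Q - u)} ∪ Ici K := by
      intro Q _
      by_cases h : K ≤ Q
      · exact Or.inr h
      · left
        simp only [mem_ofPred_eq]
        linarith [not_le.1 h]
    calc (1 : ℝ≥0∞) = radial 0 univ := measure_univ.symm
      _ ≤ _ := (measure_mono huniv).trans (measure_union_le _ _)
      _ ≤ _ := by
        gcongr
        simpa using hδ 0 le_rfl
  | succ n ih =>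
    have ih' := fun {u} => ih (fun k hk => hδ k (hk.trans n.le_succ)) (u := u)
    rw [formProb_succ (-1) (by norm_num)]
    have hpt : ∀ Q E : ℝ, 1 ≤ (if 0 < -1 * (Q - u) then
        formProb (-1) n (4 * K + u * E / (Q - u)) (4 * K) else 0) +
          ((2 * n + 1) * δ + (Ici K).indicator 1 Q + (Ici K).indicator 1 E) := by
      intro Q E
      by_cases hQ : K ≤ Q
      · rw [indicator_of_mem (by exact hQ)]
        exact le_add_left (le_add_right (le_add_left le_rfl))
      by_cases hE : K ≤ E
      · rw [indicator_of_mem (s := Ici K) (a := E) (by exact hE)]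
        exact le_add_left (le_add_left le_rfl)
      push Not at hQ hE
      have hQu : 0 < -1 * (Q - u) := by linarith
      rw [if_pos hQu]
      have hv : 2 * K ≤ 4 * K + u * E / (Q - u) := by
        have h1 : u * E / (Q - u) = -(u * E / (u - Q)) := by
          rw [← neg_sub u Q, div_neg]
        have h2 : u * E / (u - Q) ≤ 2 * K := by
          rw [div_le_iff₀ (by linarith)]
          nlinarith
        rw [h1]; linarith
      refine (ih' hv).trans ?_
      gcongr
      rw [add_assoc]
      exact le_self_add
    have hE : ∀ Q : ℝ, 1 ≤ ∫⁻ E, (if 0 < -1 * (Q - u) then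
        formProb (-1) n (4 * K + u * E / (Q - u)) (4 * K) else 0) ∂(radial n) +
          ((2 * n + 2) * δ + (Ici K).indicator 1 Q) := by
      intro Q
      calc (1 : ℝ≥0∞) = ∫⁻ _, 1 ∂(radial n) := by simp
        _ ≤ _ := lintegral_mono (hpt Q)
        _ = ∫⁻ E, (if 0 < -1 * (Q - u) then
            formProb (-1) n (4 * K + u * E / (Q - u)) (4 * K) else 0) ∂(radial n) +
            ((2 * n + 1) * δ + (Ici K).indicator 1 Q + radial n (Ici K)) := by
          have hm : Measurable ((Ici K).indicator (1 : ℝ → ℝ≥0∞)) :=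
            measurable_one.indicator measurableSet_Ici
          rw [lintegral_add_right _ (by fun_prop), lintegral_add_right _ hm,
            lintegral_indicator_one measurableSet_Ici]
          simp
        _ ≤ _ := by
          refine add_le_add le_rfl ?_
          calc (2 * n + 1) * δ + (Ici K).indicator 1 Q + radial n (Ici K)
              ≤ (2 * n + 1) * δ + (Ici K).indicator 1 Q + δ := by
                gcongr; exact hδ n n.le_succ
            _ = _ := by ring
    calc (1 : ℝ≥0∞) = ∫⁻ _, 1 ∂(radial (n + 1)) := by simp
      _ ≤ _ := lintegral_mono hE
      _ = ∫⁻ Q, ∫⁻ E, (if 0 < -1 * (Q - u) then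
            formProb (-1) n (4 * K + u * E / (Q - u)) (4 * K) else 0) ∂(radial n)
              ∂(radial (n + 1)) + ((2 * n + 2) * δ + radial (n + 1) (Ici K)) := by
          have hm : Measurable ((Ici K).indicator (1 : ℝ → ℝ≥0∞)) :=
            measurable_one.indicator measurableSet_Ici
          rw [lintegral_add_right _ (by fun_prop), lintegral_add_right _ hm,
            lintegral_indicator_one measurableSet_Ici]
          simp
      _ ≤ _ := by
          refine add_le_add le_rfl ?_
          calc (2 * n + 2) * δ + radial (n + 1) (Ici K) ≤ (2 * n + 2) * δ + δ := by
                gcongr; exact hδ _ le_rfl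
            _ = _ := by push_cast; ring

/-- If the squared lengths in the first `j` steps of the bidiagonalization exceed `K`, then each
step of the recursion of `formProb_succ` with `t = (4 - η) K` lowers the first parameter by at
least `η K`, so that `X† X ≤ t` fails once it gets below `K`. -/
lemma formProb_neg_one_le {K η : ℝ} (hK : 0 < K) {δ : ℝ≥0∞} (j n : ℕ) (hjn : j ≤ n)
    (hδ : ∀ k ≤ n, n ≤ k + j → radial k (Iic K) ≤ δ) {u : ℝ} (hu : u ≤ K * (1 + j * η)) :
    formProb (-1) n u (K * (4 - η)) ≤ (2 * j + 1) * δ := by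
  have hm : Measurable ((Iic K).indicator (1 : ℝ → ℝ≥0∞)) :=
    measurable_one.indicator measurableSet_Iic
  induction j generalizing n u with
  | zero =>
    have hu : u ≤ K := by simpa using hu
    have h0 := hδ n le_rfl le_rfl
    simp only [Nat.cast_zero, mul_zero, zero_add, one_mul]
    cases n with
    | zero =>
      rw [formProb_zero]
      refine (measure_mono fun Q hQ => ?_).trans h0
      simp only [mem_ofPred_eq] at hQ
      exact mem_Iic.2 (by linarith)
    | succ n =>
      rw [formProb_succ (-1) (by norm_num)]
      refine le_trans ?_ h0
      rw [← lintegral_indicator_one measurableSet_Iic]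
      refine lintegral_mono fun Q => ?_
      by_cases hQ : 0 < -1 * (Q - u)
      · simp only [hQ, if_true]
        rw [indicator_of_mem (mem_Iic.2 (by linarith))]
        refine (lintegral_mono (g := fun _ => 1) fun E => prob_le_one).trans ?_
        simp
      · simp only [hQ, if_false, lintegral_zero, zero_le]
  | succ j ih =>
    obtain ⟨n, rfl⟩ : ∃ m, n = m + 1 := ⟨n - 1, by omega⟩
    have ih' := fun {u} => ih n (by omega) (fun k hk hkj => hδ k (by omega) (by omega)) (u := u)
    rw [formProb_succ (-1) (by norm_num)]
    have hpt : ∀ Q E : ℝ, (if 0 < -1 * (Q - u) then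
        formProb (-1) n (K * (4 - η) + u * E / (Q - u)) (K * (4 - η)) else 0) ≤
          ((2 * j + 1) * δ + (Iic K).indicator 1 Q) + (Iic K).indicator 1 E := by
      intro Q E
      split_ifs with hQu
      swap
      · exact zero_le
      by_cases hQ : Q ≤ K
      · rw [indicator_of_mem (s := Iic K) (a := Q) (by exact hQ)]
        exact prob_le_one.trans (le_add_right (le_add_left le_rfl))
      by_cases hE : E ≤ K
      · rw [indicator_of_mem (s := Iic K) (a := E) (by exact hE)]
        exact prob_le_one.trans (le_add_left le_rfl)
      push Not at hQ hE
      refine (ih' ?_).trans (le_add_right (le_add_right le_rfl))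
      have hy : 0 < u - K := by linarith
      have h1 : u * E / (Q - u) = -(u * E / (u - Q)) := by
        rw [← neg_sub u Q, div_neg]
      have h2 : u * K / (u - K) ≤ u * E / (u - Q) := by
        have : 0 < u - Q := by linarith
        have : 0 ≤ u := by linarith
        have : 0 ≤ u * E := mul_nonneg this (by linarith)
        gcongr
      -- `K + K² / y ≥ 3 K - y` with `y = u - K`
      have h3 : 3 * K - (u - K) ≤ u * K / (u - K) := by
        rw [le_div_iff₀ hy]
        nlinarith [sq_nonneg (u - K - K)]
      push_cast at hu
      rw [h1]
      nlinarith
    have hE : ∀ Q : ℝ, ∫⁻ E, (if 0 < -1 * (Q - u) then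
        formProb (-1) n (K * (4 - η) + u * E / (Q - u)) (K * (4 - η)) else 0) ∂(radial n) ≤
          (2 * j + 2) * δ + (Iic K).indicator 1 Q := by
      intro Q
      refine (lintegral_mono (hpt Q)).trans ?_
      rw [lintegral_add_right _ hm, lintegral_indicator_one measurableSet_Iic]
      calc _ ≤ ((2 * j + 1) * δ + (Iic K).indicator 1 Q) + δ := by
            gcongr
            · simp
            · exact hδ n n.le_succ (by omega)
        _ = _ := by ring
    refine (lintegral_mono hE).trans ?_
    rw [lintegral_add_right _ hm, lintegral_indicator_one measurableSet_Iic]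
    calc _ ≤ (2 * j + 2) * δ + δ := by
          gcongr
          · simp
          · exact hδ (n + 1) le_rfl (by omega)
      _ = _ := by push_cast; ring

/-- `P(X† X ≤ 4 (1 + ε) N) → 1`. -/
theorem tendsto_formProb_neg_one_one {ε : ℝ} (hε : 0 < ε) :
    Tendsto (fun n : ℕ => formProb (-1) n (4 * ((1 + ε) * (n + 1 : ℕ)))
      (4 * ((1 + ε) * (n + 1 : ℕ)))) atTop (𝓝 1) := by
  -- The Chernoff bound with parameter `c` is exponentially small in `N` as `1 / (1 - c) < 1 + ε`.
  obtain ⟨c, hc0, hc1, hb1⟩ : ∃ c : ℝ, 0 < c ∧ c < 1 ∧ Real.exp (-c * (1 + ε)) / (1 - c) < 1 := by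
    refine ⟨ε / (2 * (1 + ε)), by positivity, ?_, ?_⟩
    · rw [div_lt_one (by positivity)]; linarith
    · set c := ε / (2 * (1 + ε)) with hc
      have hc1 : 0 < 1 - c := by
        rw [hc, sub_pos, div_lt_one (by positivity)]; linarith
      have hlt : 1 / (1 - c) < 1 + ε := by
        rw [div_lt_iff₀ hc1, hc]
        field_simp
        nlinarith
      have hc0 : 0 < c := by positivity
      have h1 : 1 / (1 - c) ≤ Real.exp (c / (1 - c)) := by
        have h := Real.add_one_le_exp (c / (1 - c))
        calc 1 / (1 - c) = c / (1 - c) + 1 := by field_simp; ring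
          _ ≤ _ := h
      have h2 : Real.exp (c / (1 - c)) < Real.exp (c * (1 + ε)) := by
        refine Real.exp_lt_exp.2 ?_
        rw [div_eq_mul_one_div]
        gcongr
      have h3 := h1.trans_lt h2
      rw [show -c * (1 + ε) = -(c * (1 + ε)) by ring, Real.exp_neg, div_lt_one hc1]
      rw [one_div] at h3
      exact inv_lt_of_inv_lt₀ hc1 h3
  set b := Real.exp (-c * (1 + ε)) / (1 - c) with hb
  have h1c : 0 < 1 - c := by linarith
  have hb0 : 0 ≤ b := by positivity
  have hlow : ∀ n : ℕ, 1 - ENNReal.ofReal ((2 * n + 1) * (b ^ 2) ^ (n + 1)) ≤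
      formProb (-1) n (4 * ((1 + ε) * (n + 1 : ℕ))) (4 * ((1 + ε) * (n + 1 : ℕ))) := by
    intro n
    rw [tsub_le_iff_right]
    have hK : 0 < (1 + ε) * (n + 1 : ℕ) := by positivity
    have := one_le_formProb_neg_one_add hK (δ := ENNReal.ofReal ((b ^ 2) ^ (n + 1))) n ?_
      (u := 4 * ((1 + ε) * (n + 1 : ℕ))) (by linarith)
    · refine this.trans_eq ?_
      rw [ENNReal.ofReal_mul (by positivity), ENNReal.ofReal_add (by positivity) zero_le_one,
        ENNReal.ofReal_mul zero_le_two, ENNReal.ofReal_natCast]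
      simp
    · intro k hk
      refine (radial_Ici_le k hc0.le hc1 _).trans (ENNReal.ofReal_le_ofReal ?_)
      rw [← pow_mul, hb, div_pow, ← Real.exp_nat_mul]
      have he : -2 * c * ((1 + ε) * (n + 1 : ℕ)) =
          ((2 * (n + 1) : ℕ) : ℝ) * (-c * (1 + ε)) := by push_cast; ring
      rw [he]
      gcongr _ / ?_
      exact pow_le_pow_of_le_one h1c.le (by linarith) (by omega)
  have hlim : Tendsto (fun n : ℕ => 1 - ENNReal.ofReal ((2 * n + 1) * (b ^ 2) ^ (n + 1))) atTop
      (𝓝 1) := by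
    have hr0 : 0 ≤ b ^ 2 := by positivity
    have hr1 : b ^ 2 < 1 := pow_lt_one₀ hb0 hb1 two_ne_zero
    have e1 := (tendsto_self_mul_const_pow_of_lt_one hr0 hr1).const_mul (2 * b ^ 2)
    have e2 := (tendsto_pow_atTop_nhds_zero_of_lt_one hr0 hr1).const_mul (b ^ 2)
    have e3 : Tendsto (fun n : ℕ => ((2 * n + 1) * (b ^ 2) ^ (n + 1) : ℝ)) atTop (𝓝 0) := by
      refine ((e1.add e2).congr fun n => ?_).trans (by simp)
      ring
    have e4 := ENNReal.tendsto_ofReal e3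
    rw [ENNReal.ofReal_zero] at e4
    simpa using ENNReal.Tendsto.sub (tendsto_const_nhds (x := (1 : ℝ≥0∞))) e4 (by simp)
  exact tendsto_of_tendsto_of_tendsto_of_le_of_le hlim tendsto_const_nhds hlow
    fun n => prob_le_one

/-- `P(X† X ≤ 4 (1 - ε) N) → 0`. -/
theorem tendsto_formProb_neg_one_zero {ε : ℝ} (hε : 0 < ε) (hε1 : ε < 1) :
    Tendsto (fun n : ℕ => formProb (-1) n (4 * ((1 - ε) * (n + 1 : ℕ)))
      (4 * ((1 - ε) * (n + 1 : ℕ)))) atTop (𝓝 0) := by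
  -- `4 (1 - ε) N` is written as `(4 - η) K` with `K = (1 - ε') N`. The parameter `u` starts
  -- below `4 K` and loses `η K` at each step, so `j ≥ 3 / η` steps bring it down to `K`.
  set ε' := ε / 2 with hε'
  have hε'0 : 0 < ε' := by positivity
  have hε'1 : 0 < 1 - ε' := by rw [hε']; linarith
  set η := 4 - 4 * (1 - ε) / (1 - ε') with hη
  have hη0 : 0 < η := by
    rw [hη, sub_pos, div_lt_iff₀ hε'1]
    linarith
  obtain ⟨j, hj⟩ : ∃ j : ℕ, 3 ≤ j * η := by
    obtain ⟨j, hj⟩ := exists_nat_ge (3 / η)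
    exact ⟨j, by rwa [div_le_iff₀ hη0] at hj⟩
  -- the base of the Chernoff bound for the lower tail, with parameter `ε'`
  set b := Real.exp (ε' * (1 - ε')) / (1 + ε') with hb
  have hb0 : 0 ≤ b := by positivity
  have hb1 : b < 1 := by
    have h1 : Real.exp (ε' / (1 + ε')) ≤ 1 + ε' := by
      have h := Real.one_sub_le_exp_neg (ε' / (1 + ε'))
      rw [Real.exp_neg] at h
      have h2 : 1 - ε' / (1 + ε') = (1 + ε')⁻¹ := by field_simp; ring
      rw [h2] at h
      exact (inv_le_inv₀ (by positivity) (by positivity)).1 h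
    have h2 : Real.exp (ε' * (1 - ε')) < Real.exp (ε' / (1 + ε')) := by
      refine Real.exp_lt_exp.2 ?_
      rw [lt_div_iff₀ (by positivity)]
      have : 0 < ε' ^ 3 := by positivity
      nlinarith
    rw [hb, div_lt_one (by positivity)]
    exact h2.trans_le h1
  have hup : ∀ᶠ n : ℕ in atTop, formProb (-1) n (4 * ((1 - ε) * (n + 1 : ℕ)))
      (4 * ((1 - ε) * (n + 1 : ℕ))) ≤
      (2 * j + 1) * ENNReal.ofReal ((1 + ε') ^ (2 * j) * (b ^ 2) ^ (n + 1)) := by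
    filter_upwards [eventually_ge_atTop j] with n hn
    have hK : 0 < (1 - ε') * (n + 1 : ℕ) := by positivity
    have ht : 4 * ((1 - ε) * (n + 1 : ℕ)) = (1 - ε') * (n + 1 : ℕ) * (4 - η) := by
      rw [hη]; field_simp; ring
    rw [ht]
    refine formProb_neg_one_le hK j n hn (fun k hk hkj => ?_) ?_
    · refine (radial_Iic_le k hε'0.le _).trans (ENNReal.ofReal_le_ofReal ?_)
      rw [← pow_mul, hb, div_pow, ← Real.exp_nat_mul]
      have he : 2 * ε' * ((1 - ε') * (n + 1 : ℕ)) =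
          ((2 * (n + 1) : ℕ) : ℝ) * (ε' * (1 - ε')) := by push_cast; ring
      rw [he, ← mul_div_assoc, div_le_div_iff₀ (by positivity) (by positivity)]
      have hp : (1 + ε') ^ (2 * (n + 1)) ≤ (1 + ε') ^ (2 * j) * (1 + ε') ^ (2 * k + 2) := by
        rw [← pow_add]
        exact pow_le_pow_right₀ (by linarith) (by omega)
      calc _ ≤ Real.exp (((2 * (n + 1) : ℕ) : ℝ) * (ε' * (1 - ε'))) *
            ((1 + ε') ^ (2 * j) * (1 + ε') ^ (2 * k + 2)) := by gcongr
        _ = _ := by ring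
    · gcongr
      linarith
  have hlim : Tendsto (fun n : ℕ => (2 * j + 1) *
      ENNReal.ofReal ((1 + ε') ^ (2 * j) * (b ^ 2) ^ (n + 1))) atTop (𝓝 0) := by
    have hr1 : b ^ 2 < 1 := pow_lt_one₀ hb0 hb1 two_ne_zero
    have e2 := ((tendsto_pow_atTop_nhds_zero_of_lt_one (by positivity) hr1).comp
      (tendsto_add_atTop_nat 1)).const_mul ((1 + ε') ^ (2 * j))
    have e4 := ENNReal.tendsto_ofReal e2
    rw [mul_zero, ENNReal.ofReal_zero] at e4
    simpa using ENNReal.Tendsto.const_mul e4 (a := 2 * j + 1)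
      (Or.inr (by finiteness))
  exact tendsto_of_tendsto_of_tendsto_of_le_of_le' tendsto_const_nhds hlim
    (Eventually.of_forall fun _ => zero_le) hup

end GinSE

/-! ### Quaternionic matrices as complex matrices, and singular values -/

namespace GinSE

open Quaternion Set

section LinearAlgebra

variable {E F : Type*} [NormedAddCommGroup E] [InnerProductSpace ℂ E] [FiniteDimensional ℂ E]
  [NormedAddCommGroup F] [InnerProductSpace ℂ F] [FiniteDimensional ℂ F]
  {ι : Type*} [Fintype ι] (T : E →ₗ[ℂ] F) (b : OrthonormalBasis ι ℂ E) {l : ι → ℝ}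

/-- Stated for any orthonormal eigenbasis of `T† T`, as the two that occur (for singular values and
for the eigenvalues of a Hermitian matrix) are chosen independently. -/
lemma norm_sq_apply_eq_sum_eigenvalues
    (h : ∀ i, (LinearMap.adjoint T ∘ₗ T) (b i) = (l i : ℂ) • b i) (v : E) :
    ‖T v‖ ^ 2 = ∑ i, l i * ‖inner ℂ (b i) v‖ ^ 2 := by
  have h1 : (‖T v‖ ^ 2 : ℂ) = inner ℂ v ((LinearMap.adjoint T ∘ₗ T) v) := by
    rw [LinearMap.comp_apply, LinearMap.adjoint_inner_right, inner_self_eq_norm_sq_to_K]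
    simp
  have h2 : (LinearMap.adjoint T ∘ₗ T) v = ∑ i, ((l i : ℂ) * inner ℂ (b i) v) • b i := by
    conv_lhs => rw [← b.sum_repr' v]
    rw [map_sum]
    refine Finset.sum_congr rfl fun i _ => ?_
    rw [map_smul, h, smul_smul, mul_comm]
  rw [h2, inner_sum] at h1
  have h3 : ∀ i, inner ℂ v (((l i : ℂ) * inner ℂ (b i) v) • b i) =
      ((l i * ‖inner ℂ (b i) v‖ ^ 2 : ℝ) : ℂ) := by
    intro i
    rw [inner_smul_right, mul_assoc, ← inner_conj_symm v (b i), RCLike.mul_conj]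
    push_cast
    rfl
  simp_rw [h3] at h1
  exact_mod_cast h1

lemma forall_mul_norm_sq_le_iff
    (h : ∀ i, (LinearMap.adjoint T ∘ₗ T) (b i) = (l i : ℂ) • b i) (s : ℝ) :
    (∀ v, s * ‖v‖ ^ 2 ≤ ‖T v‖ ^ 2) ↔ ∀ i, s ≤ l i := by
  classical
  simp_rw [norm_sq_apply_eq_sum_eigenvalues T b h]
  constructor
  · intro hv i
    have := hv (b i)
    simpa [b.inner_eq_ite, apply_ite, ite_pow] using this
  · intro hl v
    rw [← b.sum_sq_norm_inner_right v, Finset.mul_sum]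
    gcongr with i
    exact hl i

lemma forall_norm_sq_le_mul_iff
    (h : ∀ i, (LinearMap.adjoint T ∘ₗ T) (b i) = (l i : ℂ) • b i) (t : ℝ) :
    (∀ v, ‖T v‖ ^ 2 ≤ t * ‖v‖ ^ 2) ↔ ∀ i, l i ≤ t := by
  classical
  simp_rw [norm_sq_apply_eq_sum_eigenvalues T b h]
  constructor
  · intro hv i
    have := hv (b i)
    simpa [b.inner_eq_ite, apply_ite, ite_pow] using this
  · intro hl v
    rw [← b.sum_sq_norm_inner_right v, Finset.mul_sum]
    gcongr with i
    exact hl i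

lemma adjoint_comp_self_eigenvectorBasis {d : ℕ} (hd : Module.finrank ℂ E = d) (i : Fin d) :
    (LinearMap.adjoint T ∘ₗ T) (T.isSymmetric_adjoint_comp_self.eigenvectorBasis hd i) =
      ((T.singularValues i ^ 2 : ℝ) : ℂ) •
        T.isSymmetric_adjoint_comp_self.eigenvectorBasis hd i := by
  rw [T.sq_singularValues_fin hd]
  exact T.isSymmetric_adjoint_comp_self.apply_eigenvectorBasis hd i

lemma le_sq_singularValues_last_iff {d : ℕ} (hd : Module.finrank ℂ E = d + 1) (s : ℝ) :
    s ≤ T.singularValues d ^ 2 ↔ ∀ v, s * ‖v‖ ^ 2 ≤ ‖T v‖ ^ 2 := by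
  rw [forall_mul_norm_sq_le_iff T _ (adjoint_comp_self_eigenvectorBasis T hd)]
  constructor
  · intro h i
    refine h.trans (pow_le_pow_left₀ (T.singularValues_nonneg _) ?_ 2)
    exact T.singularValues_antitone (Nat.lt_succ_iff.1 i.2)
  · intro h
    simpa using h (Fin.last d)

lemma sq_singularValues_zero_le_iff {d : ℕ} (hd : Module.finrank ℂ E = d + 1) (t : ℝ) :
    T.singularValues 0 ^ 2 ≤ t ↔ ∀ v, ‖T v‖ ^ 2 ≤ t * ‖v‖ ^ 2 := by
  rw [forall_norm_sq_le_mul_iff T _ (adjoint_comp_self_eigenvectorBasis T hd)]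
  constructor
  · intro h i
    refine (pow_le_pow_left₀ (T.singularValues_nonneg _) ?_ 2).trans h
    exact T.singularValues_antitone (Nat.zero_le _)
  · intro h
    simpa using h 0

end LinearAlgebra

/-- The identification of `ℍ ^ N` with `ℂ ^ (2 N)` that sends a quaternion to the first column of
its `2 × 2` block. -/
noncomputable def toComplexVec {N : ℕ} (v : Fin N → ℍ[ℝ]) : Fin N × Fin 2 → ℂ :=
  fun p => if p.2 = 0 then ⟨(v p.1).re, (v p.1).imI⟩ else ⟨-(v p.1).imJ, (v p.1).imK⟩

lemma toComplexVec_surjective {N : ℕ} : Function.Surjective (toComplexVec (N := N)) := by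
  intro w
  refine ⟨fun k => ⟨(w (k, 0)).re, (w (k, 0)).im, -(w (k, 1)).re, (w (k, 1)).im⟩, ?_⟩
  ext1 ⟨k, c⟩
  fin_cases c <;> simp [toComplexVec]

lemma sum_norm_sq_toComplexVec {N : ℕ} (v : Fin N → ℍ[ℝ]) :
    ∑ p, ‖toComplexVec v p‖ ^ 2 = nsq v := by
  rw [Fintype.sum_prod_type, nsq]
  refine Finset.sum_congr rfl fun k _ => ?_
  rw [Fin.sum_univ_two, sq ‖v k‖, ← normSq_eq_norm_mul_self, normSq_def']
  simp [toComplexVec, Complex.sq_norm, Complex.normSq_apply]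
  ring

lemma quat_re (a : Fin 4 → ℝ) : (quat a).re = a 0 := rfl

lemma quat_imI (a : Fin 4 → ℝ) : (quat a).imI = a 1 := rfl

lemma quat_imJ (a : Fin 4 → ℝ) : (quat a).imJ = a 2 := rfl

lemma quat_imK (a : Fin 4 → ℝ) : (quat a).imK = a 3 := rfl

/-- The complex matrix of a quaternion array acts on `ℂ ^ (2 N)` as the array acts on `ℍ ^ N`. -/
lemma toMatrix_mulVec_toComplexVec {N : ℕ} (q : QuaternionArray N) (v : Fin N → ℍ[ℝ]) :
    toMatrix q *ᵥ toComplexVec v = toComplexVec (mat (toQuat q) *ᵥ v) := by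
  ext1 ⟨i, c⟩
  have hre : (∑ k, quat (q i k) * v k).re = ∑ k, (quat (q i k) * v k).re :=
    map_sum (QuaternionAlgebra.reₗ (-1 : ℝ) 0 (-1)) _ _
  have hI : (∑ k, quat (q i k) * v k).imI = ∑ k, (quat (q i k) * v k).imI :=
    map_sum (QuaternionAlgebra.imIₗ (-1 : ℝ) 0 (-1)) _ _
  have hJ : (∑ k, quat (q i k) * v k).imJ = ∑ k, (quat (q i k) * v k).imJ :=
    map_sum (QuaternionAlgebra.imJₗ (-1 : ℝ) 0 (-1)) _ _
  have hK : (∑ k, quat (q i k) * v k).imK = ∑ k, (quat (q i k) * v k).imK :=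
    map_sum (QuaternionAlgebra.imKₗ (-1 : ℝ) 0 (-1)) _ _
  have hmv : (mat (toQuat q) *ᵥ v) i = ∑ k, quat (q i k) * v k := rfl
  have hL : (toMatrix q *ᵥ toComplexVec v) (i, c) = ∑ k, ∑ e : Fin 2,
      quaternionBlock (q i k) c e * toComplexVec v (k, e) := by
    simp only [Matrix.mulVec, dotProduct, Fintype.sum_prod_type]
    rfl
  rw [hL]
  simp only [toComplexVec, hmv, hre, hI, hJ, hK]
  fin_cases c
  · apply Complex.ext <;>
      simp [quaternionBlock, quat_re, quat_imI, quat_imJ, quat_imK, Quaternion.re_mul,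
        Quaternion.imI_mul, Finset.sum_add_distrib, Finset.sum_sub_distrib] <;> ring
  · apply Complex.ext <;>
      simp [quaternionBlock, quat_re, quat_imI, quat_imJ, quat_imK, Quaternion.imJ_mul,
        Quaternion.imK_mul, Finset.sum_add_distrib, Finset.sum_sub_distrib] <;> ring

/-- The linear map of the complex matrix of `q`. -/
noncomputable abbrev linMap {N : ℕ} (q : QuaternionArray N) :
    EuclideanSpace ℂ (Fin N × Fin 2) →ₗ[ℂ] EuclideanSpace ℂ (Fin N × Fin 2) :=
  Matrix.toEuclideanLin (toMatrix q)

lemma norm_sq_linMap {N : ℕ} (q : QuaternionArray N) (v : Fin N → ℍ[ℝ]) :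
    ‖linMap q (WithLp.toLp 2 (toComplexVec v))‖ ^ 2 = nsq (mat (toQuat q) *ᵥ v) := by
  rw [EuclideanSpace.norm_sq_eq, ← sum_norm_sq_toComplexVec, ← toMatrix_mulVec_toComplexVec]
  rfl

lemma norm_sq_toLp_toComplexVec {N : ℕ} (v : Fin N → ℍ[ℝ]) :
    ‖(WithLp.toLp 2 (toComplexVec v) : EuclideanSpace ℂ (Fin N × Fin 2))‖ ^ 2 = nsq v := by
  rw [EuclideanSpace.norm_sq_eq, ← sum_norm_sq_toComplexVec]

lemma forall_euclideanSpace_iff {N : ℕ} {P : EuclideanSpace ℂ (Fin N × Fin 2) → Prop} :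
    (∀ v, P v) ↔ ∀ v : Fin N → ℍ[ℝ], P (WithLp.toLp 2 (toComplexVec v)) := by
  refine ⟨fun h v => h _, fun h v => ?_⟩
  obtain ⟨w, hw⟩ := toComplexVec_surjective v.ofLp
  have := h w
  rwa [hw] at this

lemma toQuat_mem_formSet_one_iff {n : ℕ} (q : QuaternionArray (n + 1)) (s : ℝ) :
    toQuat q ∈ formSet 1 n s s ↔ ∀ v, s * ‖v‖ ^ 2 ≤ ‖linMap q v‖ ^ 2 := by
  rw [forall_euclideanSpace_iff]
  simp_rw [norm_sq_linMap, norm_sq_toLp_toComplexVec]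
  simp [formSet, diagForm_self]

lemma toQuat_mem_formSet_neg_one_iff {n : ℕ} (q : QuaternionArray (n + 1)) (t : ℝ) :
    toQuat q ∈ formSet (-1) n t t ↔ ∀ v, ‖linMap q v‖ ^ 2 ≤ t * ‖v‖ ^ 2 := by
  rw [forall_euclideanSpace_iff]
  simp_rw [norm_sq_linMap, norm_sq_toLp_toComplexVec]
  simp [formSet, diagForm_self]

/-- The largest singular value. -/
noncomputable def sMax {N : ℕ} (q : QuaternionArray N) : ℝ := (linMap q).singularValues 0

/-- The smallest of the `2 N` singular values. -/
noncomputable def sMin {N : ℕ} (q : QuaternionArray N) : ℝ := (linMap q).singularValues (2 * N - 1)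

lemma sMax_nonneg {N : ℕ} (q : QuaternionArray N) : 0 ≤ sMax q :=
  LinearMap.singularValues_nonneg _ _

lemma sMin_nonneg {N : ℕ} (q : QuaternionArray N) : 0 ≤ sMin q :=
  LinearMap.singularValues_nonneg _ _

lemma finrank_eq (n : ℕ) :
    Module.finrank ℂ (EuclideanSpace ℂ (Fin (n + 1) × Fin 2)) = (2 * (n + 1) - 1) + 1 := by
  simp; omega

lemma le_sMin_sq_iff {n : ℕ} (q : QuaternionArray (n + 1)) (s : ℝ) :
    s ≤ sMin q ^ 2 ↔ toQuat q ∈ formSet 1 n s s := by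
  rw [sMin, le_sq_singularValues_last_iff _ (finrank_eq n), toQuat_mem_formSet_one_iff]

lemma sMax_sq_le_iff {n : ℕ} (q : QuaternionArray (n + 1)) (t : ℝ) :
    sMax q ^ 2 ≤ t ↔ toQuat q ∈ formSet (-1) n t t := by
  rw [sMax, sq_singularValues_zero_le_iff _ (finrank_eq n), toQuat_mem_formSet_neg_one_iff]

lemma law_le_sMin_sq {n : ℕ} (s : ℝ) :
    law (n + 1) {q | s ≤ sMin q ^ 2} = formProb 1 n s s := by
  simp_rw [le_sMin_sq_iff]
  exact (measurePreserving_toQuat (n + 1)).measure_preimage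
    (measurableSet_formSet _ _ _ _).nullMeasurableSet

lemma law_sMax_sq_le {n : ℕ} (t : ℝ) :
    law (n + 1) {q | sMax q ^ 2 ≤ t} = formProb (-1) n t t := by
  simp_rw [sMax_sq_le_iff]
  exact (measurePreserving_toQuat (n + 1)).measure_preimage
    (measurableSet_formSet _ _ _ _).nullMeasurableSet

lemma measurable_sMin (N : ℕ) : Measurable (sMin (N := N)) := by
  cases N with
  | zero =>
    have : (sMin : QuaternionArray 0 → ℝ) = fun _ => sMin (fun i => i.elim0) := by
      ext q; congr 1; exact Subsingleton.elim _ _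
    rw [this]; exact measurable_const
  | succ n =>
    have hsq : Measurable fun q : QuaternionArray (n + 1) => sMin q ^ 2 := by
      refine measurable_of_Ici fun s => ?_
      have : (fun q : QuaternionArray (n + 1) => sMin q ^ 2) ⁻¹' Ici s =
          toQuat ⁻¹' formSet 1 n s s := by
        ext q; exact le_sMin_sq_iff q s
      rw [this]
      exact (measurePreserving_toQuat _).measurable (measurableSet_formSet _ _ _ _)
    have : (sMin : QuaternionArray (n + 1) → ℝ) = fun q => √(sMin q ^ 2) := by
      ext q; rw [Real.sqrt_sq (sMin_nonneg q)]
    rw [this]; exact hsq.sqrt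

lemma measurable_sMax (N : ℕ) : Measurable (sMax (N := N)) := by
  cases N with
  | zero =>
    have : (sMax : QuaternionArray 0 → ℝ) = fun _ => sMax (fun i => i.elim0) := by
      ext q; congr 1; exact Subsingleton.elim _ _
    rw [this]; exact measurable_const
  | succ n =>
    have hsq : Measurable fun q : QuaternionArray (n + 1) => sMax q ^ 2 := by
      refine measurable_of_Iic fun s => ?_
      have : (fun q : QuaternionArray (n + 1) => sMax q ^ 2) ⁻¹' Iic s =
          toQuat ⁻¹' formSet (-1) n s s := by
        ext q; exact sMax_sq_le_iff q s
      rw [this]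
      exact (measurePreserving_toQuat _).measurable (measurableSet_formSet _ _ _ _)
    have : (sMax : QuaternionArray (n + 1) → ℝ) = fun q => √(sMax q ^ 2) := by
      ext q; rw [Real.sqrt_sq (sMax_nonneg q)]
    rw [this]; exact hsq.sqrt

/-- `X` is almost surely invertible, since `P(X† X ≥ s) → 1` as `s → 0`. -/
lemma ae_sMin_pos (n : ℕ) : ∀ᵐ q ∂(law (n + 1)), 0 < sMin q := by
  have hcoeff : ∀ (s : ℝ), 0 ≤ s → ∀ m, 1 ≤ (gapCoeff s m).1 := by
    intro s hs m
    induction m with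
    | zero => simp [gapCoeff]
    | succ m ih =>
      have := mul_nonneg hs (gapCoeff_nonneg hs m).2
      simp only [gapCoeff]
      linarith
  have hle : ∀ s : ℝ, 0 < s →
      ENNReal.ofReal (Real.exp (-2 * (n + 1) * s)) ≤ law (n + 1) {q | 0 < sMin q} := by
    intro s hs
    calc ENNReal.ofReal (Real.exp (-2 * (n + 1) * s)) ≤ formProb 1 n s s := by
          rw [formProb_one_self hs.le]
          exact ENNReal.ofReal_le_ofReal
            (le_mul_of_one_le_right (Real.exp_pos _).le (hcoeff s hs.le _))
      _ = law (n + 1) {q | s ≤ sMin q ^ 2} := (law_le_sMin_sq s).symm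
      _ ≤ _ := by
          refine measure_mono fun q hq => ?_
          have hq : s ≤ sMin q ^ 2 := hq
          refine (sMin_nonneg q).lt_of_ne' fun h => ?_
          rw [h] at hq
          norm_num at hq
          linarith
  have hlim : Tendsto (fun s : ℝ => ENNReal.ofReal (Real.exp (-2 * (n + 1) * s))) (𝓝[>] 0)
      (𝓝 1) := by
    have hc : Continuous fun s : ℝ => ENNReal.ofReal (Real.exp (-2 * (n + 1) * s)) :=
      ENNReal.continuous_ofReal.comp (by fun_prop)
    have := hc.tendsto 0
    simp only [mul_zero, Real.exp_zero, ENNReal.ofReal_one] at this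
    exact this.mono_left nhdsWithin_le_nhds
  have h1 : law (n + 1) {q | 0 < sMin q} = 1 :=
    le_antisymm prob_le_one (le_of_tendsto hlim (eventually_mem_nhdsWithin.mono hle))
  exact (mem_ae_iff_prob_eq_one (measurableSet_lt measurable_const (measurable_sMin _))).2 h1

lemma forall_le_wishartEigenvalues_iff {n : ℕ} (q : QuaternionArray (n + 1)) (s : ℝ) :
    (∀ i, s ≤ wishartEigenvalues q i) ↔ s ≤ sMin q ^ 2 := by
  rw [sMin, le_sq_singularValues_last_iff _ (finrank_eq n)]
  set hA := Matrix.isHermitian_conjTranspose_mul_self (toMatrix q)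
  refine (forall_mul_norm_sq_le_iff _ hA.eigenvectorBasis (fun i => ?_) s).symm
  have h1 : LinearMap.adjoint (linMap q) ∘ₗ linMap q =
      Matrix.toEuclideanLin ((toMatrix q)ᴴ * toMatrix q) := by
    rw [linMap, ← Matrix.toEuclideanLin_conjTranspose_eq_adjoint]
    ext v
    simp [Matrix.toLpLin_apply]
  rw [h1]
  have := hA.mulVec_eigenvectorBasis i
  rw [Matrix.toLpLin_apply, this]
  rfl

/-- The gap event allows zero eigenvalues, which occur with probability zero. -/
lemma gapProb_eq (n : ℕ) (s : ℝ) :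
    gapProb (n + 1) s = (formProb 1 n s s).toReal := by
  rw [gapProb, ← law_le_sMin_sq, measureReal_def]
  congr 1
  refine measure_congr ?_
  filter_upwards [ae_sMin_pos n] with q hq
  refine propext ?_
  change (∀ i, wishartEigenvalues q i ∉ Ioo 0 s) ↔ s ≤ sMin q ^ 2
  rw [← forall_le_wishartEigenvalues_iff]
  have h0 : ∀ i, sMin q ^ 2 ≤ wishartEigenvalues q i :=
    (forall_le_wishartEigenvalues_iff q _).2 le_rfl
  have hq2 : 0 < sMin q ^ 2 := by positivity
  refine forall_congr' fun i => ?_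
  have := hq2.trans_le (h0 i)
  simp [this]

end GinSE

/-! ### The limit law of the condition number -/

namespace GinSE

open Set

/-- The hard edge gap probability `exp (-2 x) cosh (2 √x)`. -/
noncomputable def edgeGap (x : ℝ) : ℝ := Real.exp (-2 * x) * Real.cosh (2 * √x)

lemma edgeGap_zero : edgeGap 0 = 1 := by simp [edgeGap]

lemma continuous_edgeGap : Continuous edgeGap := by
  unfold edgeGap; fun_prop

lemma edgeGap_pos (x : ℝ) : 0 < edgeGap x :=
  mul_pos (Real.exp_pos _) (Real.cosh_pos _)

lemma edgeGap_le {x : ℝ} (hx : 0 ≤ x) : edgeGap x ≤ Real.exp (1 - x) := by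
  have h1 : Real.cosh (2 * √x) ≤ Real.exp (2 * √x) := by
    rw [Real.cosh_eq]
    have : Real.exp (-(2 * √x)) ≤ Real.exp (2 * √x) :=
      Real.exp_le_exp.2 (by have := Real.sqrt_nonneg x; linarith)
    linarith
  calc edgeGap x ≤ Real.exp (-2 * x) * Real.exp (2 * √x) := by
        unfold edgeGap; gcongr
    _ = Real.exp (-2 * x + 2 * √x) := (Real.exp_add _ _).symm
    _ ≤ _ := Real.exp_le_exp.2 (by nlinarith [sq_nonneg (√x - 1), Real.sq_sqrt hx])

lemma tendsto_edgeGap_atTop : Tendsto edgeGap atTop (𝓝 0) := by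
  have h : Tendsto (fun x : ℝ => Real.exp (1 - x)) atTop (𝓝 0) :=
    Real.tendsto_exp_atBot.comp (tendsto_atBot_add_const_left _ _ tendsto_neg_atTop_atBot)
  refine tendsto_of_tendsto_of_tendsto_of_le_of_le' tendsto_const_nhds h
    (Eventually.of_forall fun x => (edgeGap_pos x).le) ?_
  filter_upwards [eventually_ge_atTop 0] with x hx using edgeGap_le hx

lemma hasDerivAt_edgeGap {x : ℝ} (hx : 0 < x) :
    HasDerivAt edgeGap
      (Real.exp (-2 * x) * (Real.sinh (2 * √x) / √x - 2 * Real.cosh (2 * √x))) x := by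
  have h1 : HasDerivAt (fun x : ℝ => Real.exp (-2 * x)) (Real.exp (-2 * x) * (-2)) x := by
    simpa using ((hasDerivAt_id x).const_mul (-2)).exp
  have h2 : HasDerivAt (fun x : ℝ => Real.cosh (2 * √x))
      (Real.sinh (2 * √x) * (2 * (1 / (2 * √x)))) x :=
    ((Real.hasDerivAt_sqrt hx.ne').const_mul 2).cosh
  have hs : √x ≠ 0 := (Real.sqrt_pos.2 hx).ne'
  convert! h1.mul h2 using 1
  field_simp
  ring

lemma deriv_edgeGap_nonpos {x : ℝ} (hx : 0 < x) : deriv edgeGap x ≤ 0 := by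
  rw [(hasDerivAt_edgeGap hx).deriv]
  refine mul_nonpos_of_nonneg_of_nonpos (Real.exp_pos _).le ?_
  have hs : 0 < √x := Real.sqrt_pos.2 hx
  -- `sinh t ≤ t cosh t` for `t ≥ 0`
  have h2 : Real.sinh (2 * √x) ≤ 2 * √x * Real.cosh (2 * √x) := by
    have ht : 0 ≤ 2 * √x := by positivity
    have hmono : MonotoneOn (fun t : ℝ => t * Real.cosh t - Real.sinh t) (Ici 0) := by
      refine monotoneOn_of_deriv_nonneg (convex_Ici 0) (by fun_prop) (by fun_prop) ?_
      intro t ht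
      rw [interior_Ici] at ht
      have hd : HasDerivAt (fun t : ℝ => t * Real.cosh t - Real.sinh t)
          (1 * Real.cosh t + t * Real.sinh t - Real.cosh t) t :=
        ((hasDerivAt_id t).mul (Real.hasDerivAt_cosh t)).sub (Real.hasDerivAt_sinh t)
      rw [hd.deriv]
      have := mul_nonneg (le_of_lt ht) (Real.sinh_nonneg_iff.2 (le_of_lt ht))
      linarith
    have := hmono (mem_Ici.2 le_rfl) (mem_Ici.2 ht) ht
    simp at this
    linarith
  rw [sub_nonpos, div_le_iff₀ hs]
  linarith

lemma limitPDF_nonneg (y : ℝ) : 0 ≤ limitPDF y := by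
  unfold limitPDF
  split_ifs with hy
  · have h : deriv edgeGap (1 / y ^ 2) ≤ 0 := deriv_edgeGap_nonpos (by positivity)
    exact mul_nonneg_of_nonpos_of_nonpos (neg_nonpos.2 (by positivity)) h
  · exact le_rfl

/-- The distribution function of `limitLaw`. -/
noncomputable def limitCDF (y : ℝ) : ℝ := if 0 < y then edgeGap (1 / y ^ 2) else 0

lemma limitCDF_nonneg (y : ℝ) : 0 ≤ limitCDF y := by
  unfold limitCDF
  split_ifs
  · exact (edgeGap_pos _).le
  · exact le_rfl

lemma hasDerivAt_limitCDF {y : ℝ} (hy : 0 < y) : HasDerivAt limitCDF (limitPDF y) y := by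
  have h1 : HasDerivAt (fun y : ℝ => 1 / y ^ 2) (-(2 / y ^ 3)) y := by
    have := (hasDerivAt_pow 2 y).fun_inv (pow_ne_zero 2 hy.ne')
    convert! this using 1
    · ext; simp
    · field_simp; norm_num
  have h2 := (hasDerivAt_edgeGap (x := 1 / y ^ 2) (by positivity)).differentiableAt.hasDerivAt.comp
    y h1
  have h3 : limitPDF y = deriv edgeGap (1 / y ^ 2) * -(2 / y ^ 3) := by
    rw [limitPDF, if_pos hy, mul_comm]; rfl
  rw [h3]
  refine h2.congr_of_eventuallyEq ?_
  filter_upwards [eventually_gt_nhds hy] with z hz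
  simp [limitCDF, hz]

lemma tendsto_limitCDF_zero : Tendsto limitCDF (𝓝[>] 0) (𝓝 0) := by
  have h1 : Tendsto (fun y : ℝ => 1 / y ^ 2) (𝓝[>] 0) atTop := by
    have := (tendsto_pow_atTop (α := ℝ) two_ne_zero).comp tendsto_inv_nhdsGT_zero
    refine this.congr fun y => ?_
    simp
  refine (tendsto_edgeGap_atTop.comp h1).congr' ?_
  filter_upwards [self_mem_nhdsWithin] with y hy
  simp [limitCDF, mem_Ioi.1 hy]

lemma continuousOn_limitCDF (y : ℝ) : ContinuousOn limitCDF (Icc 0 y) := by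
  intro x hx
  rcases hx.1.eq_or_lt with rfl | hx0
  · have h0 : limitCDF 0 = 0 := by simp [limitCDF]
    have : ContinuousWithinAt limitCDF (Ioi 0) 0 := by
      rw [ContinuousWithinAt, h0]; exact tendsto_limitCDF_zero
    refine (continuousWithinAt_Ioi_iff_Ici.1 this).mono Icc_subset_Ici_self
  · exact (hasDerivAt_limitCDF hx0).continuousAt.continuousWithinAt

lemma limitLaw_Iic (y : ℝ) : limitLaw (Iic y) = ENNReal.ofReal (limitCDF y) := by
  rw [limitLaw, withDensity_apply _ measurableSet_Iic]
  have hneg : ∀ z : ℝ, z ≤ 0 → ENNReal.ofReal (limitPDF z) = 0 := by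
    intro z hz
    simp [limitPDF, hz.not_gt]
  rcases le_or_gt y 0 with hy | hy
  · rw [setLIntegral_congr_fun measurableSet_Iic
      (fun z hz => hneg z ((mem_Iic.1 hz).trans hy))]
    simp [limitCDF, hy.not_gt]
  · have hsplit : Iic y = Iic 0 ∪ Ioc 0 y := (Iic_union_Ioc_eq_Iic hy.le).symm
    rw [hsplit, lintegral_union measurableSet_Ioc
      (by rw [disjoint_left]; intro z h1 h2; exact (not_lt.2 h1) h2.1),
      setLIntegral_congr_fun measurableSet_Iic (fun z hz => hneg z hz)]
    have hint := intervalIntegral.integrableOn_deriv_of_nonneg (continuousOn_limitCDF y)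
      (fun z hz => hasDerivAt_limitCDF hz.1) (fun z _ => limitPDF_nonneg z)
    have hFTC := intervalIntegral.integral_eq_sub_of_hasDerivAt_of_le hy.le
      (continuousOn_limitCDF y) (fun z hz => hasDerivAt_limitCDF hz.1)
      ((intervalIntegrable_iff_integrableOn_Ioc_of_le hy.le).2 hint)
    rw [intervalIntegral.integral_of_le hy.le] at hFTC
    rw [← ofReal_integral_eq_lintegral_ofReal hint (ae_of_all _ limitPDF_nonneg), hFTC]
    simp [limitCDF]

lemma isProbabilityMeasure_limitLaw : IsProbabilityMeasure limitLaw := by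
  refine ⟨tendsto_nhds_unique (tendsto_measure_Iic_atTop limitLaw) ?_⟩
  simp_rw [limitLaw_Iic]
  have h1 : Tendsto (fun y : ℝ => 1 / y ^ 2) atTop (𝓝 0) := by
    refine (tendsto_inv_atTop_zero.comp (tendsto_pow_atTop (α := ℝ) two_ne_zero)).congr fun y => ?_
    simp
  have h2 := (continuous_edgeGap.tendsto 0).comp h1
  rw [edgeGap_zero] at h2
  have h3 : Tendsto limitCDF atTop (𝓝 1) := by
    refine h2.congr' ?_
    filter_upwards [eventually_gt_atTop 0] with y hy
    simp [limitCDF, hy]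
  simpa using ENNReal.tendsto_ofReal h3

/-- Convergence of distribution functions to a distribution function, at all points, implies weak
convergence. -/
lemma tendsto_probabilityMeasure_of_forall_Iic {ι : Type*} {l : Filter ι} [l.IsCountablyGenerated]
    {μ : ι → ProbabilityMeasure ℝ} {ν : ProbabilityMeasure ℝ}
    (h : ∀ y, Tendsto (fun i => (μ i : Measure ℝ).real (Iic y)) l
      (𝓝 ((ν : Measure ℝ).real (Iic y)))) : Tendsto μ l (𝓝 ν) := by
  have hIoc : ∀ (ρ : ProbabilityMeasure ℝ) {a b : ℝ}, a ≤ b →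
      (ρ : Measure ℝ).real (Ioc a b) =
        (ρ : Measure ℝ).real (Iic b) - (ρ : Measure ℝ).real (Iic a) := by
    intro ρ a b hab
    rw [← Iic_sdiff_Iic, measureReal_sdiff (Iic_subset_Iic.2 hab) measurableSet_Iic]
  refine IsPiSystem.tendsto_probabilityMeasure_of_tendsto_of_mem
    (S := {S | ∃ a b : ℝ, a < b ∧ Ioc a b = S}) ?_ ?_ ?_ ?_
  · exact isPiSystem_Ioc (id : ℝ → ℝ) id
  · rintro _ ⟨a, b, -, rfl⟩; exact measurableSet_Ioc
  · intro u hu x hx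
    obtain ⟨a, b, hab, hsub⟩ := mem_nhds_iff_exists_Ioo_subset.1 (hu.mem_nhds hx)
    obtain ⟨c, hxc, hcb⟩ := exists_between hab.2
    refine ⟨Ioc a c, ⟨a, c, hab.1.trans hxc, rfl⟩, Ioc_mem_nhds hab.1 hxc, ?_⟩
    exact (fun z hz => hsub ⟨hz.1, hz.2.trans_lt hcb⟩)
  · rintro _ ⟨a, b, hab, rfl⟩
    have := (h b).sub (h a)
    rw [← hIoc ν hab.le] at this
    simp_rw [← hIoc _ hab.le] at this
    rw [← NNReal.tendsto_coe]
    exact this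

lemma conditionNumber_eq {N : ℕ} (q : QuaternionArray N) : conditionNumber q = sMax q / sMin q :=
  rfl

lemma measurable_conditionNumber (N : ℕ) : Measurable (conditionNumber (N := N)) :=
  (measurable_sMax N).div (measurable_sMin N)

lemma real_le_sMin_sq (n : ℕ) (s : ℝ) :
    (law (n + 1)).real {q | s ≤ sMin q ^ 2} = (formProb 1 n s s).toReal := by
  rw [measureReal_def, law_le_sMin_sq]

lemma real_sMax_sq_le (n : ℕ) (t : ℝ) :
    (law (n + 1)).real {q | sMax q ^ 2 ≤ t} = (formProb (-1) n t t).toReal := by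
  rw [measureReal_def, law_sMax_sq_le]

lemma conditionNumber_le_iff {n : ℕ} {q : QuaternionArray (n + 1)} (hq : 0 < sMin q) {y : ℝ}
    (hy : 0 < y) : conditionNumber q / (2 * (n + 1 : ℕ)) ≤ y ↔
      sMax q ^ 2 ≤ 4 * (n + 1 : ℕ) ^ 2 * y ^ 2 * sMin q ^ 2 := by
  rw [conditionNumber_eq, div_div, div_le_iff₀ (by positivity),
    ← sq_le_sq₀ (sMax_nonneg q) (by positivity)]
  ring_nf

/-- The limit of the distribution function of the scaled condition number, at positive `y`: as the
largest singular value is asymptotic to `2 √N`, the event `κ ≤ 2 N y` is asymptotically the event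
that the smallest singular value is at least `1 / (y √N)`. -/
lemma tendsto_real_conditionNumber_le_of_pos {y : ℝ} (hy : 0 < y) :
    Tendsto (fun n : ℕ => (law (n + 1)).real {q | conditionNumber q / (2 * (n + 1 : ℕ)) ≤ y}) atTop
      (𝓝 (edgeGap (1 / y ^ 2))) := by
  set x := 1 / y ^ 2 with hx
  have hx0 : 0 < x := by positivity
  have hxy : x * y ^ 2 = 1 := by rw [hx]; field_simp
  have hup : ∀ {ε : ℝ}, 0 < ε → ε < 1 → ∀ n : ℕ,
      (law (n + 1)).real {q | conditionNumber q / (2 * (n + 1 : ℕ)) ≤ y} ≤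
        (formProb (-1) n (4 * ((1 - ε) * (n + 1 : ℕ))) (4 * ((1 - ε) * (n + 1 : ℕ)))).toReal +
        (formProb 1 n ((1 - ε) * x / (n + 1 : ℕ)) ((1 - ε) * x / (n + 1 : ℕ))).toReal := by
    intro ε hε hε1 n
    rw [← real_le_sMin_sq, ← real_sMax_sq_le]
    refine le_trans (ENNReal.toReal_mono (measure_ne_top _ _) (measure_mono_ae ?_))
      (measureReal_union_le _ _)
    filter_upwards [ae_sMin_pos n] with q hq hqy
    have h := (conditionNumber_le_iff hq hy).1 hqy
    by_cases hmax : sMax q ^ 2 ≤ 4 * ((1 - ε) * (n + 1 : ℕ))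
    · exact Or.inl hmax
    · right
      change (1 - ε) * x / (n + 1 : ℕ) ≤ sMin q ^ 2
      have hN : (0 : ℝ) < (n + 1 : ℕ) := by positivity
      have h2 := (not_le.1 hmax).le.trans h
      rw [div_le_iff₀ hN]
      have h3 : (1 - ε) ≤ (n + 1 : ℕ) * y ^ 2 * sMin q ^ 2 := by
        refine le_of_mul_le_mul_left ?_ (mul_pos four_pos hN)
        linarith
      calc (1 - ε) * x ≤ (n + 1 : ℕ) * y ^ 2 * sMin q ^ 2 * x := by gcongr
        _ = sMin q ^ 2 * (n + 1 : ℕ) * (x * y ^ 2) := by ring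
        _ = _ := by rw [hxy, mul_one]
  -- `P(A ∩ B) ≥ P(A) + P(B) - 1`
  have hlow : ∀ {ε : ℝ}, 0 < ε → ∀ n : ℕ,
      (formProb 1 n ((1 + ε) * x / (n + 1 : ℕ)) ((1 + ε) * x / (n + 1 : ℕ))).toReal +
        (formProb (-1) n (4 * ((1 + ε) * (n + 1 : ℕ))) (4 * ((1 + ε) * (n + 1 : ℕ)))).toReal - 1 ≤
      (law (n + 1)).real {q | conditionNumber q / (2 * (n + 1 : ℕ)) ≤ y} := by
    intro ε hε n
    rw [← real_le_sMin_sq, ← real_sMax_sq_le]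
    have hmeas : MeasurableSet {q : QuaternionArray (n + 1) |
        sMax q ^ 2 ≤ 4 * ((1 + ε) * (n + 1 : ℕ))} :=
      measurableSet_le ((measurable_sMax _).pow_const 2) measurable_const
    have hui := measureReal_union_add_inter (μ := law (n + 1))
      (s := {q | (1 + ε) * x / (n + 1 : ℕ) ≤ sMin q ^ 2}) hmeas
    have hle : (law (n + 1)).real ({q | (1 + ε) * x / (n + 1 : ℕ) ≤ sMin q ^ 2} ∪
      {q | sMax q ^ 2 ≤ 4 * ((1 + ε) * (n + 1 : ℕ))}) ≤ 1 := measureReal_le_one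
    have hsub : {q | (1 + ε) * x / (n + 1 : ℕ) ≤ sMin q ^ 2} ∩
        {q | sMax q ^ 2 ≤ 4 * ((1 + ε) * (n + 1 : ℕ))} ⊆
        {q : QuaternionArray (n + 1) | conditionNumber q / (2 * (n + 1 : ℕ)) ≤ y} := by
      rintro q ⟨h1, h2⟩
      have h1 : (1 + ε) * x / (n + 1 : ℕ) ≤ sMin q ^ 2 := h1
      have h2 : sMax q ^ 2 ≤ 4 * ((1 + ε) * (n + 1 : ℕ)) := h2
      have hN : (0 : ℝ) < (n + 1 : ℕ) := by positivity
      have hpos : 0 < sMin q ^ 2 := lt_of_lt_of_le (by positivity) h1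
      have hq : 0 < sMin q := (sMin_nonneg q).lt_of_ne' fun h => by simp [h] at hpos
      refine (conditionNumber_le_iff hq hy).2 (h2.trans ?_)
      rw [div_le_iff₀ hN] at h1
      have h3 : 1 + ε ≤ sMin q ^ 2 * (n + 1 : ℕ) * y ^ 2 := by
        calc 1 + ε = (1 + ε) * x * y ^ 2 := by rw [mul_assoc, hxy, mul_one]
          _ ≤ _ := by gcongr
      calc 4 * ((1 + ε) * ((n + 1 : ℕ) : ℝ))
          ≤ 4 * ((sMin q ^ 2 * (n + 1 : ℕ) * y ^ 2) * (n + 1 : ℕ)) := by gcongr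
        _ = _ := by ring
    have := measureReal_mono (μ := law (n + 1)) hsub
    linarith
  have hcont : ∀ σ : ℝ, Tendsto (fun ε : ℝ => edgeGap ((1 + σ * ε) * x)) (𝓝[>] 0)
      (𝓝 (edgeGap x)) := by
    intro σ
    have : Continuous fun ε : ℝ => edgeGap ((1 + σ * ε) * x) :=
      continuous_edgeGap.comp (by fun_prop)
    have := this.tendsto 0
    simp only [mul_zero, add_zero, one_mul] at this
    exact this.mono_left nhdsWithin_le_nhds
  refine tendsto_order.2 ⟨fun a ha => ?_, fun a ha => ?_⟩
  · obtain ⟨ε, hεa, hε⟩ :=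
      (((hcont 1).eventually (lt_mem_nhds ha)).and self_mem_nhdsWithin).exists
    have hε : 0 < ε := hε
    have h1 := tendsto_formProb_one (x := (1 + ε) * x) (by positivity)
    have h2 := (ENNReal.tendsto_toReal ENNReal.one_ne_top).comp (tendsto_formProb_neg_one_one hε)
    have h3 := (h1.add h2).sub_const 1
    rw [ENNReal.toReal_one, add_sub_cancel_right] at h3
    rw [one_mul] at hεa
    filter_upwards [h3.eventually (lt_mem_nhds hεa)] with n hn
    exact hn.trans_le (hlow hε n)
  · obtain ⟨ε, ⟨hεa, hε1⟩, hε⟩ :=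
      ((((hcont (-1)).eventually (gt_mem_nhds ha)).and
        (nhdsWithin_le_nhds (gt_mem_nhds one_pos))).and self_mem_nhdsWithin).exists
    have hε : 0 < ε := hε
    have hε1 : ε < 1 := hε1
    have h1 := tendsto_formProb_one (x := (1 - ε) * x)
      (mul_nonneg (by linarith) hx0.le)
    have h2 := (ENNReal.tendsto_toReal ENNReal.zero_ne_top).comp
      (tendsto_formProb_neg_one_zero hε hε1)
    have h3 := h2.add h1
    rw [ENNReal.toReal_zero, zero_add] at h3
    rw [neg_one_mul, ← sub_eq_add_neg] at hεa
    filter_upwards [h3.eventually (gt_mem_nhds hεa)] with n hn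
    exact (hup hε hε1 n).trans_lt hn

lemma tendsto_real_conditionNumber_le (y : ℝ) :
    Tendsto (fun n : ℕ => (law (n + 1)).real {q | conditionNumber q / (2 * (n + 1 : ℕ)) ≤ y}) atTop
      (𝓝 (limitCDF y)) := by
  rcases lt_or_ge 0 y with hy | hy
  · rw [limitCDF, if_pos hy]
    exact tendsto_real_conditionNumber_le_of_pos hy
  · rw [limitCDF, if_neg hy.not_gt]
    refine tendsto_order.2 ⟨fun a ha => Eventually.of_forall fun n =>
      ha.trans_le measureReal_nonneg, fun a ha => ?_⟩
    -- for `y ≤ 0` the probability is at most that for a small positive `z`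
    obtain ⟨z, hza, hz⟩ :=
      ((tendsto_limitCDF_zero.eventually (gt_mem_nhds ha)).and self_mem_nhdsWithin).exists
    have hz : 0 < z := hz
    rw [limitCDF, if_pos hz] at hza
    filter_upwards [(tendsto_real_conditionNumber_le_of_pos hz).eventually (gt_mem_nhds hza)]
      with n hn
    refine lt_of_le_of_lt (measureReal_mono fun q hq => ?_) hn
    exact le_trans hq (hy.trans hz.le)

lemma tendstoInDistribution_conditionNumber :
    haveI := isProbabilityMeasure_limitLaw
    TendstoInDistribution
      (fun (N : ℕ) (q : QuaternionArray N) => conditionNumber q / (2 * N)) atTop id law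
      limitLaw := by
  have := isProbabilityMeasure_limitLaw
  have hm : ∀ N : ℕ, Measurable fun q : QuaternionArray N => conditionNumber q / (2 * N) :=
    fun N => (measurable_conditionNumber N).div_const _
  refine ⟨fun N => (hm N).aemeasurable, aemeasurable_id,
    tendsto_probabilityMeasure_of_forall_Iic fun y => ?_⟩
  change Tendsto (fun N : ℕ => ((law N).map fun q => conditionNumber q / (2 * N)).real (Iic y))
    atTop (𝓝 ((limitLaw.map id).real (Iic y)))
  rw [Measure.map_id, measureReal_def (μ := limitLaw), limitLaw_Iic,
    ENNReal.toReal_ofReal (limitCDF_nonneg y), ← tendsto_add_atTop_iff_nat 1]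
  refine (tendsto_real_conditionNumber_le y).congr fun n => ?_
  rw [map_measureReal_apply (hm (n + 1)) measurableSet_Iic]
  rfl

lemma tendsto_gapProb {x : ℝ} (hx : 0 ≤ x) :
    Tendsto (fun N : ℕ => gapProb N (x / N)) atTop
      (𝓝 (Real.exp (-2 * x) * Real.cosh (2 * √x))) := by
  rw [← tendsto_add_atTop_iff_nat 1]
  simp_rw [gapProb_eq]
  exact tendsto_formProb_one hx

end GinSE

theorem mainTheorem8 :
    (∀ x : ℝ, 0 ≤ x →
      Tendsto (fun N : ℕ => GinSE.gapProb N (x / N)) atTop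
          (𝓝 (Real.exp (-2 * x) * GinSE.hypergeometric0F1 (1 / 2) x)) ∧
        Real.exp (-2 * x) * GinSE.hypergeometric0F1 (1 / 2) x =
          Real.exp (-2 * x) * Real.cosh (2 * √x)) ∧
    (∀ y : ℝ, 0 ≤ GinSE.limitPDF y) ∧
    ∃ _ : IsProbabilityMeasure GinSE.limitLaw,
      TendstoInDistribution
        (fun (N : ℕ) (q : GinSE.QuaternionArray N) => GinSE.conditionNumber q / (2 * N))
        atTop id GinSE.law GinSE.limitLaw := by
  refine ⟨fun x hx => ?_, GinSE.limitPDF_nonneg, GinSE.isProbabilityMeasure_limitLaw,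
    GinSE.tendstoInDistribution_conditionNumber⟩
  rw [GinSE.hypergeometric0F1_half hx]
  exact ⟨GinSE.tendsto_gapProb hx, rfl⟩
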